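/- **Structures.** A structure is a triple $U=(A,F,P)$, where $A$ is a nonempty set, $F$ is a set of functions $f:A^n\to A$ ($n\ge 0$), $P$ is a nonempty set of predicates $p:A^n\to\{0,1\}$ ($n\ge 1$), and $F\cap P=\emptyset$. Let $X=\{x_0,x_1,\dots\}$ be the set of variables and $\omega=\{0,1,2,\dots\}$. Functional expressions have the form $x_j\Leftarrow f(x_{l_1},\dots,x_{l_r})$ with $f\in F$, and predicate expressions have the form $p(x_{q_1},\dots,x_{q_k})$ with $p\in P$. Given a finite nonempty set $Y\subset X$ of input variables and a finite sequence $\beta$ of expressions, execute $\beta$ as a straight-line program: initially each $x_j\in Y$ holds its input value, each $x_j\notin Y$ holds the value of the variable of $Y$ with minimum index, and functional expressions are assignments. The successive predicate expressions then define functions $\alpha_1,\dots,\alpha_r:A^{|Y|}\to\{0,1\}$ of the input. **Problems.** A problem is $z=(Y,\nu,\beta_1,\dots,\beta_m)$, where $Y\subset X$ is finite and nonempty, $\beta_1,\dots,\beta_m$ are expressions of which exactly $r\ge 1$ are predicate expressions, and $\nu$ maps $\{0,1\}^r$ to the nonempty finite subsets of $\omega$. Put $z(\bar a)=\nu(\alpha_1(\bar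 a),\dots,\alpha_r(\bar a))$ for $\bar a\in A^{|Y|}$. **Computation trees.** A computation tree $\Gamma$ is a finite nonempty set $Y\subset X$ together with a finite rooted directed tree with at least two nodes, in which the root is unlabeled, each terminal node is labeled with a number from $\omega$, every other node except the root is labeled with a functional or predicate expression, and the edges leaving predicate nodes (and only these) are labeled with numbers from $\{0,1\}$. It is deterministic if exactly one edge leaves the root, exactly one edge leaves each functional node, and the edges leaving any predicate node have pairwise different labels. For a complete path $\xi$ (from the root to a terminal node) let $\beta(\xi)$ be its sequence of expressions, $\kappa(\xi)$ the label of its terminal node, and $\mathcal A(\xi)\subseteq A^{|Y|}$ the set of inputs for which the predicate expressions of $\beta(\xi)$ take the values that label the corresponding edges of $\xi$. The tree $\Gamma$ solves $z$ nondeterministically if it has the same set $Y$ as $z$, the sets $\mathcal A(\xi)$ cover $A^{|Y|}$, and $\kappa(\xi)\in z(\bar a)$ whenever $\bar a\in\mathcal A(\xi)$. It solves $z$ deterministically if, in addition, it is deterministic. **Complexity.** An sm-pair $(U,\psi)$ is a structure $U$ with an arbitrary map $\psi:(F\cup P)^*\to\omega$ on finite words. For a finite sequence $\beta$ of expressions let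 $\psi(\beta)$ be the value of $\psi$ on the word of function and predicate symbols of $\beta$, and let $\psi(\Gamma)=\max_\xi\psi(\beta(\xi))$ over the complete paths $\xi$ of $\Gamma$. Let $\psi_U^i(z)=\psi(\beta_1,\dots,\beta_m)$, and let $\psi_U^d(z)$ and $\psi_U^a(z)$ be the minimum of $\psi(\Gamma)$ over the trees $\Gamma$ that solve $z$ deterministically and nondeterministically, respectively. For $n\ge 1$ and $b,c\in\{i,d,a\}$ define partial functions $\omega\to\omega$ by $$\mathcal U_n^{bc}(m)=\max\{\psi_U^b(z):\psi_U^c(z)\le m\},\qquad \mathcal L_n^{bc}(m)=\min\{\psi_U^b(z):\psi_U^c(z)\ge m\},$$ where $z$ ranges over the problems with $|Y|=n$. A value is undefined when the maximum or minimum does not exist. **Types.** For a partial function $g$ from $\omega$ to $\omega$ let $D^+=\{k\in \mathrm{Dom}(g):g(k)\ge k\}$ and $D^-=\{k\in\mathrm{Dom}(g):g(k)\le k\}$. The type $typ(g)$ is $\alpha$ if $\mathrm{Dom}(g)$ is infinite and $g$ is bounded from above; $\beta$ if $\mathrm{Dom}(g)$ is infinite, $D^+$ is finite and $g$ is unbounded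 from above; $\gamma$ if $D^+$ and $D^-$ are both infinite; $\delta$ if $\mathrm{Dom}(g)$ is infinite and $D^-$ is finite; $\varepsilon$ if $\mathrm{Dom}(g)$ is finite. The $n$-type $typ(U,\psi,n)$ is the $3\times 3$ table with rows $b$ and columns $c$ in the order $i,d,a$ and entries $typ(\mathcal L^{bc}_n)\,typ(\mathcal U^{bc}_n)$. The dynamic type $dtyp(U,\psi)$ is the infinite sequence $typ(U,\psi,1)\,typ(U,\psi,2)\cdots$. Define $$T_1=\begin{pmatrix}\varepsilon\alpha&\varepsilon\alpha&\varepsilon\alpha\\ \varepsilon\alpha&\varepsilon\alpha&\varepsilon\alpha\\ \varepsilon\alpha&\varepsilon\alpha&\varepsilon\alpha\end{pmatrix},\quad T_2=\begin{pmatrix}\gamma\gamma&\varepsilon\varepsilon&\varepsilon\varepsilon\\ \alpha\alpha&\varepsilon\alpha&\varepsilon\alpha\\ \alpha\alpha&\varepsilon\alpha&\varepsilon\alpha\end{pmatrix},\quad T_3=\begin{pmatrix}\gamma\gamma&\delta\varepsilon&\varepsilon\varepsilon\\ \alpha\beta&\gamma\gamma&\varepsilon\varepsilon\\ \alpha\alpha&\alpha\alpha&\varepsilon\alpha\end{pmatrix},\quad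 T_4=\begin{pmatrix}\gamma\gamma&\gamma\varepsilon&\varepsilon\varepsilon\\ \alpha\gamma&\gamma\gamma&\varepsilon\varepsilon\\ \alpha\alpha&\alpha\alpha&\varepsilon\alpha\end{pmatrix},$$ $$T_5=\begin{pmatrix}\gamma\gamma&\gamma\varepsilon&\gamma\varepsilon\\ \alpha\gamma&\gamma\gamma&\gamma\gamma\\ \alpha\gamma&\gamma\gamma&\gamma\gamma\end{pmatrix},\quad T_6=\begin{pmatrix}\gamma\gamma&\gamma\varepsilon&\gamma\varepsilon\\ \alpha\gamma&\gamma\gamma&\gamma\delta\\ \alpha\gamma&\beta\gamma&\gamma\gamma\end{pmatrix},\quad T_7=\begin{pmatrix}\gamma\gamma&\gamma\varepsilon&\gamma\varepsilon\\ \alpha\gamma&\gamma\gamma&\gamma\varepsilon\\ \alpha\gamma&\alpha\gamma&\gamma\gamma\end{pmatrix}.$$ Write $T^i$ for $T$ repeated $i\ge 0$ times and $T^\infty=TTT\cdots$, and let $$\Delta=\{T_2^\infty,\;T_2^iT_3^\infty,\;T_2^iT_3^jT_4^\infty,\;T_2^iT_3^jT_4^kT_7^\infty,\;T_2^iT_5^\infty,\;T_2^iT_5^jT_6^\infty,\;T_2^iT_5^jT_6^kT_7^\infty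 : i,j,k\in\omega\}.$$ **Theorem.** For every sm-pair $(U,\psi)$, $dtyp(U,\psi)\in\{T_1^\infty\}\cup\Delta$. Conversely, for every $\sigma\in\{T_1^\infty\}\cup\Delta$ there is an sm-pair $(U,\psi)$ with $dtyp(U,\psi)=\sigma$. Consequently, for every $n\ge 1$, the set of all $n$-types of sm-pairs is exactly $\{T_1,\dots,T_7\}$. -/

import Mathlib

universe u

namespace SMPairs

/-- A structure `U = (A, F, P)`: a nonempty set `A`, a set `F` of finitary functions
`Aⁿ → A` (`n ≥ 0`) and a nonempty set `P` of predicates `Aⁿ → {0,1}` (`n ≥ 1`).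
The set `E₂ = {0,1}` is `Bool`. -/
structure Struc : Type (u + 1) where
  A : Type u
  A_nonempty : Nonempty A
  F : Set (Σ n : ℕ, (Fin n → A) → A)
  P : Set (Σ n : ℕ, (Fin n → A) → Bool)
  P_nonempty : P.Nonempty
  P_arity : ∀ p ∈ P, 0 < p.1

/-- The alphabet `F ∪ P` (the union is disjoint). -/
abbrev Struc.Symbol (U : Struc.{u}) : Type u := U.F ⊕ U.P

/-- A functional expression `x_j ⇐ f(x_{l_1}, …, x_{l_r})`; the variable `x_j` is given by `j`. -/
structure FuncExpr (U : Struc.{u}) : Type u where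
  target : ℕ
  f : U.F
  args : Fin f.1.1 → ℕ

/-- A predicate expression `p(x_{q_1}, …, x_{q_k})`. -/
structure PredExpr (U : Struc.{u}) : Type u where
  p : U.P
  args : Fin p.1.1 → ℕ

inductive Expr (U : Struc.{u}) : Type u
  | func (e : FuncExpr U)
  | pred (e : PredExpr U)

/-- The symbol of `F ∪ P` that occurs in an expression. -/
def Expr.symbol {U : Struc.{u}} : Expr U → U.Symbol
  | .func e => Sum.inl e.f
  | .pred e => Sum.inr e.p

def Expr.isPred {U : Struc.{u}} : Expr U → Bool
  | .func _ => false
  | .pred _ => true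

/-- The number of predicate expressions in a sequence of expressions. -/
def numPred {U : Struc.{u}} (β : List (Expr U)) : ℕ := β.countP Expr.isPred

/-- The sequence `t_0`: for each variable `x_j`, a function of the variables from `Y`. It is
`x_j` if `x_j ∈ Y`, and otherwise the variable of `Y` with the minimum index. -/
def initTerms (U : Struc.{u}) (Y : Finset ℕ) (hY : Y.Nonempty) : ℕ → (Y → U.A) → U.A :=
  fun j a => if h : j ∈ Y then a ⟨j, h⟩ else a ⟨Y.min' hY, Y.min'_mem hY⟩

/-- The passage from `t_i` to `t_{i+1}` at a functional expression. -/
def assign {U : Struc.{u}} {Y : Finset ℕ} (t : ℕ → (Y → U.A) → U.A) (e : FuncExpr U) :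
    ℕ → (Y → U.A) → U.A :=
  Function.update t e.target (fun a => e.f.1.2 (fun l => t (e.args l) a))

/-- The functions associated with the predicate expressions of a sequence, starting from the
sequence of functions `t`. -/
def predFuns {U : Struc.{u}} {Y : Finset ℕ} :
    (ℕ → (Y → U.A) → U.A) → List (Expr U) → List ((Y → U.A) → Bool)
  | _, [] => []
  | t, .func e :: β => predFuns (assign t e) β
  | t, .pred e :: β => (fun a => e.p.1.2 (fun l => t (e.args l) a)) :: predFuns t β

/-- The tuple `Π(Y, β) = (α_1, …, α_r)`. -/
def Pi {U : Struc.{u}} (Y : Finset ℕ) (hY : Y.Nonempty) (β : List (Expr U)) :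
    List ((Y → U.A) → Bool) :=
  predFuns (initTerms U Y hY) β

theorem length_predFuns {U : Struc.{u}} {Y : Finset ℕ} (t : ℕ → (Y → U.A) → U.A)
    (β : List (Expr U)) : (predFuns t β).length = numPred β := by
  induction β generalizing t with
  | nil => rfl
  | cons e β ih =>
    cases e with
    | func e =>
      have h : Expr.isPred (Expr.func e) = false := rfl
      simp [predFuns, numPred, h, ih]
    | pred e =>
      have h : Expr.isPred (Expr.pred e) = true := rfl
      simp [predFuns, numPred, h, ih]

/-! ### Computation trees -/

/-- A node of a computation tree that is not the root, with everything below it: a terminal node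
labeled with a natural number, a functional node, or a predicate node. A working node has at
least one leaving edge, and the edges leaving a predicate node are labeled with numbers
from `{0,1}`. -/
inductive Node (U : Struc.{u}) : Type u
  | terminal (v : ℕ) : Node U
  | func (e : FuncExpr U) (k : ℕ) (child : Fin (k + 1) → Node U) : Node U
  | pred (e : PredExpr U) (k : ℕ) (label : Fin (k + 1) → Bool)
      (child : Fin (k + 1) → Node U) : Node U

/-- A computation tree `Γ = (Y, G)`. The unlabeled root has `k + 1 ≥ 1` leaving edges. -/
structure CompTree (U : Struc.{u}) : Type u where
  Y : Finset ℕ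
  Y_nonempty : Y.Nonempty
  k : ℕ
  child : Fin (k + 1) → Node U

def Node.IsDet {U : Struc.{u}} : Node U → Prop
  | .terminal _ => True
  | .func _ k child => k = 0 ∧ ∀ i, (child i).IsDet
  | .pred _ _ label child => Function.Injective label ∧ ∀ i, (child i).IsDet

/-- Deterministic computation trees. -/
def CompTree.IsDet {U : Struc.{u}} (Γ : CompTree U) : Prop :=
  Γ.k = 0 ∧ ∀ i, (Γ.child i).IsDet

/-- A working node on a path, with the label of the edge along which the path leaves it. -/
inductive Step (U : Struc.{u}) : Type u
  | func (e : FuncExpr U)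
  | pred (e : PredExpr U) (δ : Bool)

def Step.expr {U : Struc.{u}} : Step U → Expr U
  | .func e => .func e
  | .pred e _ => .pred e

def Step.label? {U : Struc.{u}} : Step U → Option Bool
  | .func _ => none
  | .pred _ δ => some δ

/-- A complete path: its working nodes with the labels of their leaving edges, and the
number `κ` assigned to its terminal node. -/
structure Path (U : Struc.{u}) : Type u where
  steps : List (Step U)
  κ : ℕ

def Path.cons {U : Struc.{u}} (s : Step U) (ξ : Path U) : Path U := ⟨s :: ξ.steps, ξ.κ⟩

/-- The sequence of expressions `β(ξ)`. -/
def Path.β {U : Struc.{u}} (ξ : Path U) : List (Expr U) := ξ.steps.map Step.expr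

/-- The labels `δ_1, …, δ_r` of the edges leaving the predicate nodes of `ξ`. -/
def Path.δ {U : Struc.{u}} (ξ : Path U) : List Bool := ξ.steps.filterMap Step.label?

/-- The paths from a node to the terminal nodes below it. -/
def Node.paths {U : Struc.{u}} : Node U → List (Path U)
  | .terminal v => [⟨[], v⟩]
  | .func e k child =>
      (List.finRange (k + 1)).flatMap fun i => (child i).paths.map (Path.cons (.func e))
  | .pred e k label child =>
      (List.finRange (k + 1)).flatMap fun i =>
        (child i).paths.map (Path.cons (.pred e (label i)))

/-- The complete paths of a computation tree. -/
def CompTree.paths {U : Struc.{u}} (Γ : CompTree U) : List (Path U) :=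
  (List.finRange (Γ.k + 1)).flatMap fun i => (Γ.child i).paths

/-- The set `𝒜(ξ)` of solutions of the system `α_1 = δ_1, …, α_r = δ_r`, for a path `ξ` in a
tree with the set of input variables `Y`. -/
def Path.sol {U : Struc.{u}} (Y : Finset ℕ) (hY : Y.Nonempty) (ξ : Path U) :
    Set (Y → U.A) :=
  {a | (Pi Y hY ξ.β).map (fun α => α a) = ξ.δ}

/-! ### Problems -/

/-- A problem `z = (Y, ν, β_1, …, β_m)` with `r ≥ 1` predicate expressions and
`ν : {0,1}^r → S(ω)`, where `S(ω)` is the set of nonempty finite sets of natural numbers. -/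
structure Problem (U : Struc.{u}) : Type u where
  Y : Finset ℕ
  Y_nonempty : Y.Nonempty
  β : List (Expr U)
  r_pos : 0 < numPred β
  ν : List.Vector Bool (numPred β) → {s : Finset ℕ // s.Nonempty}

/-- The set `z(a) = ν(α_1(a), …, α_r(a))` of admissible answers. -/
def Problem.answers {U : Struc.{u}} (z : Problem U) (a : z.Y → U.A) : Finset ℕ :=
  (z.ν ⟨(Pi z.Y z.Y_nonempty z.β).map (fun α => α a), by
    rw [List.length_map]; exact length_predFuns _ _⟩).1

/-- `Γ` solves `z` nondeterministically. -/
def CompTree.SolvesNondet {U : Struc.{u}} (Γ : CompTree U) (z : Problem U) : Prop :=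
  z.Y = Γ.Y ∧
  (∀ a : z.Y → U.A, ∃ ξ ∈ Γ.paths, a ∈ ξ.sol z.Y z.Y_nonempty) ∧
  (∀ a : z.Y → U.A, ∀ ξ ∈ Γ.paths, a ∈ ξ.sol z.Y z.Y_nonempty → ξ.κ ∈ z.answers a)

/-- `Γ` solves `z` deterministically. -/
def CompTree.SolvesDet {U : Struc.{u}} (Γ : CompTree U) (z : Problem U) : Prop :=
  Γ.IsDet ∧ Γ.SolvesNondet z

/-! ### Complexity measures -/

/-- An sm-pair: a structure `U` with an arbitrary map `ψ : (F ∪ P)* → ω`. -/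
structure SMPair : Type (u + 1) where
  U : Struc.{u}
  ψ : List U.Symbol → ℕ

namespace SMPair

/-- The extension of `ψ` to sequences of expressions. -/
def seqCost (S : SMPair.{u}) (β : List (Expr S.U)) : ℕ := S.ψ (β.map Expr.symbol)

/-- The `ψ`-complexity of a computation tree: the maximum over its complete paths. -/
def treeCost (S : SMPair.{u}) (Γ : CompTree S.U) : ℕ :=
  Multiset.sup (Γ.paths.map (fun ξ => S.seqCost ξ.β) : Multiset ℕ)

end SMPair

/-- The three indices `i`, `d`, `a`. -/
inductive Par
  | i | d | a

namespace SMPair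

/-- The parameters `ψ_U^i(z)`, `ψ_U^d(z)`, `ψ_U^a(z)`. -/
noncomputable def cost (S : SMPair.{u}) : Par → Problem S.U → ℕ
  | .i, z => S.seqCost z.β
  | .d, z => sInf {c | ∃ Γ : CompTree S.U, Γ.SolvesDet z ∧ S.treeCost Γ = c}
  | .a, z => sInf {c | ∃ Γ : CompTree S.U, Γ.SolvesNondet z ∧ S.treeCost Γ = c}

end SMPair

/-! ### Types of partial functions -/

/-- The maximum of a set of natural numbers, defined if the maximum exists. -/
noncomputable def maxPart (s : Set ℕ) : Part ℕ := ⟨∃ k, IsGreatest s k, fun h => h.choose⟩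

/-- The minimum of a set of natural numbers, defined if the minimum exists. -/
noncomputable def minPart (s : Set ℕ) : Part ℕ := ⟨∃ k, IsLeast s k, fun h => h.choose⟩

namespace SMPair

/-- The partial function `𝒰^{bc}` for problems with `n` input variables. -/
noncomputable def upper (S : SMPair.{u}) (n : ℕ) (b c : Par) : ℕ →. ℕ := fun m =>
  maxPart {k | ∃ z : Problem S.U, z.Y.card = n ∧ S.cost c z ≤ m ∧ S.cost b z = k}

/-- The partial function `ℒ^{bc}` for problems with `n` input variables. -/
noncomputable def lower (S : SMPair.{u}) (n : ℕ) (b c : Par) : ℕ →. ℕ := fun m =>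
  minPart {k | ∃ z : Problem S.U, z.Y.card = n ∧ m ≤ S.cost c z ∧ S.cost b z = k}

end SMPair

inductive Typ
  | α | β | γ | δ | ε

def domPlus (g : ℕ →. ℕ) : Set ℕ := {n | ∃ k ∈ g n, n ≤ k}

def domMinus (g : ℕ →. ℕ) : Set ℕ := {n | ∃ k ∈ g n, k ≤ n}

/-- `g` is bounded from above. -/
def BddFun (g : ℕ →. ℕ) : Prop := ∃ c, ∀ n, ∀ k ∈ g n, k ≤ c

/-- The partial function `g` has the given type. -/
def HasTyp (g : ℕ →. ℕ) : Typ → Prop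
  | .α => g.Dom.Infinite ∧ BddFun g
  | .β => g.Dom.Infinite ∧ (domPlus g).Finite ∧ ¬ BddFun g
  | .γ => (domPlus g).Infinite ∧ (domMinus g).Infinite
  | .δ => g.Dom.Infinite ∧ (domMinus g).Finite
  | .ε => g.Dom.Finite

theorem dom_eq_union (g : ℕ →. ℕ) : g.Dom = domPlus g ∪ domMinus g := by
  ext n
  simp only [PFun.mem_dom, domPlus, domMinus, Set.mem_union, Set.mem_ofPred_eq]
  constructor
  · rintro ⟨k, hk⟩
    rcases le_total n k with h | h
    · exact Or.inl ⟨k, hk, h⟩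
    · exact Or.inr ⟨k, hk, h⟩
  · rintro (⟨k, hk, -⟩ | ⟨k, hk, -⟩) <;> exact ⟨k, hk⟩

theorem domPlus_finite_of_bdd {g : ℕ →. ℕ} (h : BddFun g) : (domPlus g).Finite := by
  obtain ⟨c, hc⟩ := h
  exact (Set.finite_Iic c).subset fun n ⟨k, hk, hn⟩ => hn.trans (hc n k hk)

/-- Every partial function has exactly one type. -/
theorem existsUnique_hasTyp (g : ℕ →. ℕ) : ∃! t, HasTyp g t := by
  have hU : g.Dom.Finite ↔ (domPlus g).Finite ∧ (domMinus g).Finite := by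
    rw [dom_eq_union, Set.finite_union]
  have hB := @domPlus_finite_of_bdd g
  have key : ∃ t, HasTyp g t := by
    by_cases h0 : g.Dom.Finite
    · exact ⟨.ε, h0⟩
    by_cases h1 : BddFun g
    · exact ⟨.α, h0, h1⟩
    by_cases h2 : (domPlus g).Finite
    · exact ⟨.β, h0, h2, h1⟩
    by_cases h3 : (domMinus g).Finite
    · exact ⟨.δ, h0, h3⟩
    · exact ⟨.γ, h2, h3⟩
  obtain ⟨t, ht⟩ := key
  refine ⟨t, ht, fun s hs => ?_⟩
  cases s <;> cases t <;> simp only [HasTyp, Set.Infinite] at hs ht <;> first | rfl | tauto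

/-- The type of a partial function. -/
noncomputable def typ (g : ℕ →. ℕ) : Typ := (existsUnique_hasTyp g).choose

theorem typ_eq_iff (g : ℕ →. ℕ) (t : Typ) : typ g = t ↔ HasTyp g t :=
  ⟨fun h => h ▸ (existsUnique_hasTyp g).choose_spec.1,
    fun h => ((existsUnique_hasTyp g).choose_spec.2 t h).symm⟩

/-! ### Tables, `n`-types and dynamic types -/

/-- A table: the rows and the columns are labeled with `i`, `d`, `a`; an entry is the pair of a
lower type and an upper type. -/
abbrev Table : Type := Par → Par → Typ × Typ

/-- A list of three entries, in the order `i`, `d`, `a`. -/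
def triple {X : Type} (x y z : X) : Par → X
  | .i => x
  | .d => y
  | .a => z

open Typ in
def T1 : Table := triple
  (triple (ε, α) (ε, α) (ε, α))
  (triple (ε, α) (ε, α) (ε, α))
  (triple (ε, α) (ε, α) (ε, α))

open Typ in
def T2 : Table := triple
  (triple (γ, γ) (ε, ε) (ε, ε))
  (triple (α, α) (ε, α) (ε, α))
  (triple (α, α) (ε, α) (ε, α))

open Typ in
def T3 : Table := triple
  (triple (γ, γ) (δ, ε) (ε, ε))
  (triple (α, β) (γ, γ) (ε, ε))
  (triple (α, α) (α, α) (ε, α))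

open Typ in
def T4 : Table := triple
  (triple (γ, γ) (γ, ε) (ε, ε))
  (triple (α, γ) (γ, γ) (ε, ε))
  (triple (α, α) (α, α) (ε, α))

open Typ in
def T5 : Table := triple
  (triple (γ, γ) (γ, ε) (γ, ε))
  (triple (α, γ) (γ, γ) (γ, γ))
  (triple (α, γ) (γ, γ) (γ, γ))

open Typ in
def T6 : Table := triple
  (triple (γ, γ) (γ, ε) (γ, ε))
  (triple (α, γ) (γ, γ) (γ, δ))
  (triple (α, γ) (β, γ) (γ, γ))

open Typ in
def T7 : Table := triple
  (triple (γ, γ) (γ, ε) (γ, ε))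
  (triple (α, γ) (γ, γ) (γ, ε))
  (triple (α, γ) (α, γ) (γ, γ))

namespace SMPair

/-- The `n`-type of an sm-pair. -/
noncomputable def nTyp (S : SMPair.{u}) (n : ℕ) : Table := fun b c =>
  (typ (S.lower n b c), typ (S.upper n b c))

/-- The dynamic type: the sequence of the `1`-type, the `2`-type, and so on. -/
noncomputable def dtyp (S : SMPair.{u}) : Stream' Table := fun k => S.nTyp (k + 1)

end SMPair

/-- The finite sequence `T^i`. -/
abbrev pow (T : Table) (i : ℕ) : List Table := List.replicate i T

/-- The infinite sequence `T^∞`. -/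
abbrev inf (T : Table) : Stream' Table := Stream'.const T

/-- The set `Δ`; `l ++ₛ s` is the finite sequence `l` followed by the infinite sequence `s`. -/
def Delta : Set (Stream' Table) :=
  {inf T2}
  ∪ {σ | ∃ i : ℕ, σ = pow T2 i ++ₛ inf T3}
  ∪ {σ | ∃ i j : ℕ, σ = (pow T2 i ++ pow T3 j) ++ₛ inf T4}
  ∪ {σ | ∃ i j k : ℕ, σ = (pow T2 i ++ pow T3 j ++ pow T4 k) ++ₛ inf T7}
  ∪ {σ | ∃ i : ℕ, σ = pow T2 i ++ₛ inf T5}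
  ∪ {σ | ∃ i j : ℕ, σ = (pow T2 i ++ pow T5 j) ++ₛ inf T6}
  ∪ {σ | ∃ i j k : ℕ, σ = (pow T2 i ++ pow T5 j ++ pow T6 k) ++ₛ inf T7}

end SMPairs

/-! For fixed `n` the table is decided by six yes-or-no conditions (`nTyp_eq`): whether each of the
parameters `i`, `d`, `a` is unbounded (`Unb`), whether `d` and `i` coincide at arbitrarily large
values (`EqInf`), whether `d` is unbounded where `a` is bounded (`DetUnb`), and whether every large
bound is respected by `a` but exceeded by `d` on some problem (`Gap`). The inequalities `a ≤ d ≤ i`,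
together with problems that have an expensive description and a constant answer, settle many
entries. If `a` is unbounded, all entries but two are settled by `exists_cost_a_eq_i`: a large value
`c` of `a` is also taken by a problem with `a = d = i = c`. Otherwise each path of an optimal cover
could be replaced by paths of cost at most `c - 1` that recompute its predicate values.

An input variable that nothing reads changes no parameter (`exists_problem_succ`). Hence each
condition persists once it holds for some `n`, and unboundedness of `i` does not depend on `n` at
all. So a dynamic type is encoded by the first `n` at which each condition holds. The constraints
`Unb a → Unb d`, `EqInf → Unb d`, and `Unb d` without `Unb a` implies `DetUnb`, leave exactly the
sequences of `Δ` (`dtyp_mem`).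

Conversely, each condition can be switched on at a prescribed `n` by one kind of predicate. A kind
with gate `g` has arity `g + 1` and is constantly false unless its arguments are pairwise different,
so it is useless for `n ≤ g`. The cost of a word is the maximum of its length and its weights. Free
thresholds give `DetUnb`: two of them certify a position, while finding it needs logarithmic depth;
yet they do not give `EqInf`, since the middle one of three makes another superfluous. Free
arbitrary sets give `EqInf` with `a` bounded, because an atom is a one-query certificate. Thresholds
`t` of weight `2 ^ t` make `a` unbounded, but a budget `2 ^ s` admits so few of them that all can be
asked, so there is no `Gap`. Thresholds of logarithmic weight give `Gap`, but only finitely many fit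
each budget, so `DetUnb` still fails. Choosing the gates realizes all of `Δ`; the zero measure gives
the remaining sequence. -/

namespace SMPairs

/-! ### Pointwise semantics of sequences of expressions -/

section Semantics

variable {U : Struc.{u}}

/-- The contents of all variables before the first expression is executed. -/
def env (Y : Finset ℕ) (hY : Y.Nonempty) (a : Y → U.A) : ℕ → U.A :=
  fun j => initTerms U Y hY j a

/-- The value of a predicate expression when the variables hold the values `s`. -/
def PredExpr.eval (e : PredExpr U) (s : ℕ → U.A) : Bool := e.p.1.2 fun l => s (e.args l)

/-- The values of the successive predicate expressions, from the variable contents `s`. -/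
def evalPreds : (ℕ → U.A) → List (Expr U) → List Bool
  | _, [] => []
  | s, .func e :: β =>
      evalPreds (Function.update s e.target (e.f.1.2 fun l => s (e.args l))) β
  | s, .pred e :: β => e.eval s :: evalPreds s β

/-- Symbolic execution commutes with substitution of one input, so everything below can work with
variable contents instead of functions of the input. -/
theorem map_predFuns {Y : Finset ℕ} (t : ℕ → (Y → U.A) → U.A) (β : List (Expr U))
    (a : Y → U.A) :
    (predFuns t β).map (fun α => α a) = evalPreds (fun j => t j a) β := by
  induction β generalizing t with
  | nil => rfl
  | cons e β ih =>
    cases e with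
    | func e =>
      simp only [predFuns, evalPreds, ih]
      congr 1
      funext j
      by_cases h : j = e.target
      · subst h; simp [assign]
      · simp [assign, h]
    | pred e => simp [predFuns, evalPreds, ih, PredExpr.eval]

theorem length_evalPreds (s : ℕ → U.A) (β : List (Expr U)) :
    (evalPreds s β).length = numPred β := by
  induction β generalizing s with
  | nil => rfl
  | cons e β ih =>
    cases e with
    | func e =>
      have h : Expr.isPred (Expr.func e) = false := rfl
      simp [evalPreds, numPred, h, ih]
    | pred e =>
      have h : Expr.isPred (Expr.pred e) = true := rfl
      simp [evalPreds, numPred, h, ih]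

theorem Path.length_δ (ξ : Path U) : ξ.δ.length = numPred ξ.β := by
  obtain ⟨l, v⟩ := ξ
  simp only [Path.δ, Path.β, numPred]
  induction l with
  | nil => rfl
  | cons s l ih =>
    cases s with
    | func e =>
      have h : Expr.isPred (Expr.func e) = false := rfl
      rw [List.filterMap_cons_none rfl, ih, List.map_cons, List.countP_cons_of_neg (by simp [Step.expr, h])]
    | pred e b =>
      have h : Expr.isPred (Expr.pred e) = true := rfl
      simp [Step.label?, Step.expr, h, ih]

/-- The path `ξ` is consistent with the variable contents `s`. -/
def Path.Accepts (ξ : Path U) (s : ℕ → U.A) : Prop := evalPreds s ξ.β = ξ.δ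

theorem Path.mem_sol {Y : Finset ℕ} {hY : Y.Nonempty} {ξ : Path U} {a : Y → U.A} :
    a ∈ ξ.sol Y hY ↔ ξ.Accepts (env Y hY a) := by
  simp only [Path.sol, Set.mem_ofPred_eq, Pi, map_predFuns, Path.Accepts]
  rfl

/-- The admissible answers when the variables hold the values `s`. -/
def Problem.ans (z : Problem U) (s : ℕ → U.A) : Finset ℕ :=
  (z.ν ⟨evalPreds s z.β, length_evalPreds s z.β⟩).1

theorem Problem.answers_eq (z : Problem U) (a : z.Y → U.A) :
    z.answers a = z.ans (env z.Y z.Y_nonempty a) := by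
  simp only [Problem.answers, Problem.ans, Pi, map_predFuns]
  rfl

theorem Problem.ans_congr (z : Problem U) {s s' : ℕ → U.A}
    (h : evalPreds s z.β = evalPreds s' z.β) : z.ans s = z.ans s' := by
  simp only [Problem.ans, h]

/-- The problem in which the only admissible answer is a function `g` of the values of the
predicate expressions. -/
def Problem.ofFun (Y : Finset ℕ) (hY : Y.Nonempty) (β : List (Expr U)) (h : 0 < numPred β)
    (g : List Bool → ℕ) : Problem U :=
  ⟨Y, hY, β, h, fun v => ⟨{g v.1}, Finset.singleton_nonempty _⟩⟩

theorem Problem.ans_ofFun (Y : Finset ℕ) (hY : Y.Nonempty) (β : List (Expr U))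
    (h : 0 < numPred β) (g : List Bool → ℕ) (s : ℕ → U.A) :
    (Problem.ofFun Y hY β h g).ans s = {g (evalPreds s β)} := rfl

-- The answers depend on the input only through the predicate values, so knowing these values is
-- enough to answer.
open Classical in
theorem Problem.exists_answer_fun (z : Problem U) :
    ∃ f : List Bool → ℕ, ∀ s, f (evalPreds s z.β) ∈ z.ans s := by
  refine ⟨fun l => if h : l.length = numPred z.β then (z.ν ⟨l, h⟩).2.choose else 0, fun s => ?_⟩
  beta_reduce
  rw [dif_pos (length_evalPreds _ _)]
  exact (z.ν _).2.choose_spec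

/-- A list of paths that covers all inputs and gives only admissible answers. -/
def PathsSolve (Ξ : List (Path U)) (z : Problem U) : Prop :=
  ∀ a, (∃ ξ ∈ Ξ, ξ.Accepts (env z.Y z.Y_nonempty a)) ∧
    ∀ ξ ∈ Ξ, ξ.Accepts (env z.Y z.Y_nonempty a) → ξ.κ ∈ z.ans (env z.Y z.Y_nonempty a)

theorem CompTree.solvesNondet_iff (Γ : CompTree U) (z : Problem U) :
    Γ.SolvesNondet z ↔ z.Y = Γ.Y ∧ PathsSolve Γ.paths z := by
  simp only [CompTree.SolvesNondet, PathsSolve, Path.mem_sol, Problem.answers_eq, forall_and]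

/-! ### Building trees -/

/-- The chain of nodes along a path. -/
def chain (v : ℕ) : List (Step U) → Node U
  | [] => .terminal v
  | .func e :: l => .func e 0 fun _ => chain v l
  | .pred e b :: l => .pred e 0 (fun _ => b) fun _ => chain v l

theorem paths_chain (v : ℕ) (l : List (Step U)) : (chain v l).paths = [⟨l, v⟩] := by
  induction l with
  | nil => rfl
  | cons s l ih => cases s <;> simp [chain, Node.paths, ih, Path.cons, List.finRange_succ]

/-- The root may have any positive number of leaving edges, so a separate chain can be hung below it
for each path. This reduces nondeterministic solvability to lists of paths. -/
theorem exists_tree_of_paths (Y : Finset ℕ) (hY : Y.Nonempty) (Ξ : List (Path U)) (h : Ξ ≠ []) :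
    ∃ Γ : CompTree U, Γ.Y = Y ∧ Γ.paths = Ξ := by
  obtain ⟨n, hn⟩ : ∃ n, Ξ.length = n + 1 := Nat.exists_eq_succ_of_ne_zero (by simpa using h)
  refine ⟨⟨Y, hY, n, fun i => chain (Ξ[i.1]'(by omega)).κ (Ξ[i.1]'(by omega)).steps⟩, rfl, ?_⟩
  simp only [CompTree.paths, paths_chain]
  rw [← List.map_eq_flatMap]
  apply List.ext_getElem <;> simp [hn]

/-- A predicate node with two leaving edges. -/
def branch (e : PredExpr U) (N : Bool → Node U) : Node U :=
  .pred e 1 (fun i => decide (i = 1)) fun i => N (decide (i = 1))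

theorem mem_paths_branch {e : PredExpr U} {N : Bool → Node U} {ξ : Path U} :
    ξ ∈ (branch e N).paths ↔ ∃ b, ∃ ξ' ∈ (N b).paths, Path.cons (.pred e b) ξ' = ξ := by
  simp [branch, Node.paths, List.finRange_succ, Bool.exists_bool]

theorem isDet_branch {e : PredExpr U} {N : Bool → Node U} (h : ∀ b, (N b).IsDet) :
    (branch e N).IsDet := by
  refine ⟨?_, fun i => h _⟩
  intro i j hij
  fin_cases i <;> fin_cases j <;> simp_all

/-- The tree that executes all of `β` and then answers by the function `f` of the values. -/
def complete : List (Expr U) → (List Bool → ℕ) → Node U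
  | [], f => .terminal (f [])
  | .func e :: β, f => .func e 0 fun _ => complete β f
  | .pred e :: β, f => branch e fun b => complete β fun l => f (b :: l)

theorem isDet_complete (β : List (Expr U)) (f : List Bool → ℕ) : (complete β f).IsDet := by
  induction β generalizing f with
  | nil => trivial
  | cons e β ih =>
    cases e with
    | func e => exact ⟨rfl, fun _ => ih _⟩
    | pred e => exact isDet_branch fun b => ih _

theorem β_of_mem_complete {β : List (Expr U)} {f : List Bool → ℕ} {ξ : Path U}
    (h : ξ ∈ (complete β f).paths) : ξ.β = β := by
  induction β generalizing f ξ with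
  | nil =>
    simp only [complete, Node.paths, List.mem_singleton] at h
    subst h; rfl
  | cons e β ih =>
    cases e with
    | func e =>
      simp only [complete, Node.paths, List.finRange_succ, List.mem_flatMap, List.mem_map] at h
      obtain ⟨_, _, ξ', h', rfl⟩ := h
      simpa [Path.β, Path.cons, Step.expr] using ih h'
    | pred e =>
      simp only [complete, mem_paths_branch] at h
      obtain ⟨b, ξ', h', rfl⟩ := h
      simpa [Path.β, Path.cons, Step.expr] using ih h'

/-- Started with the variable contents `s`, the tree below the node gives an answer, and all
its answers are in `T`. -/
def Node.Answers (N : Node U) (s : ℕ → U.A) (T : Finset ℕ) : Prop :=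
  (∃ ξ ∈ N.paths, ξ.Accepts s) ∧ ∀ ξ ∈ N.paths, ξ.Accepts s → ξ.κ ∈ T

theorem Path.accepts_cons_pred {e : PredExpr U} {b : Bool} {ξ : Path U} {s : ℕ → U.A} :
    (Path.cons (.pred e b) ξ).Accepts s ↔ e.eval s = b ∧ ξ.Accepts s := by
  simp [Path.Accepts, Path.cons, Path.β, Path.δ, Step.expr, Step.label?, evalPreds]

theorem Path.accepts_cons_func {e : FuncExpr U} {ξ : Path U} {s : ℕ → U.A} :
    (Path.cons (.func e) ξ).Accepts s ↔
      ξ.Accepts (Function.update s e.target (e.f.1.2 fun l => s (e.args l))) := by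
  have h : List.filterMap Step.label? (Step.func e :: ξ.steps) =
    List.filterMap Step.label? ξ.steps := List.filterMap_cons_none rfl
  simp [Path.Accepts, Path.cons, Path.β, Path.δ, Step.expr, evalPreds, h]

/-- Paths through the edge with the wrong label accept nothing, so only the subtree chosen by the
actual value matters. -/
theorem answers_branch {e : PredExpr U} {N : Bool → Node U} {s : ℕ → U.A} {T : Finset ℕ}
    (h : (N (e.eval s)).Answers s T) : (branch e N).Answers s T := by
  obtain ⟨⟨ξ, hξ, ha⟩, h2⟩ := h
  refine ⟨⟨_, mem_paths_branch.2 ⟨_, ξ, hξ, rfl⟩, Path.accepts_cons_pred.2 ⟨rfl, ha⟩⟩, ?_⟩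
  intro ξ' hξ' ha'
  obtain ⟨b, ξ'', h'', rfl⟩ := mem_paths_branch.1 hξ'
  obtain ⟨rfl, h3⟩ := Path.accepts_cons_pred.1 ha'
  exact h2 ξ'' h'' h3

theorem answers_complete {β : List (Expr U)} {f : List Bool → ℕ} {s : ℕ → U.A} {T : Finset ℕ}
    (h : f (evalPreds s β) ∈ T) : (complete β f).Answers s T := by
  induction β generalizing f s with
  | nil =>
    refine ⟨⟨⟨[], f []⟩, by simp [complete, Node.paths], rfl⟩, ?_⟩
    intro ξ hξ _
    simp only [complete, Node.paths, List.mem_singleton] at hξ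
    subst hξ; exact h
  | cons e β ih =>
    cases e with
    | func e =>
      obtain ⟨⟨ξ, hξ, ha⟩, h2⟩ := ih h
      have key : ∀ ξ : Path U, ξ ∈ (complete (.func e :: β) f).paths ↔
          ∃ ξ' ∈ (complete β f).paths, Path.cons (.func e) ξ' = ξ := by
        intro ξ; simp [complete, Node.paths, List.finRange_succ]
      refine ⟨⟨_, (key _).2 ⟨ξ, hξ, rfl⟩, Path.accepts_cons_func.2 ha⟩, ?_⟩
      intro ξ' hξ' ha'
      obtain ⟨ξ'', h'', rfl⟩ := (key _).1 hξ'
      exact h2 ξ'' h'' (Path.accepts_cons_func.1 ha')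
    | pred e => exact answers_branch (ih h)

theorem exists_tree_of_node (z : Problem U) (N : Node U) (hN : N.IsDet)
    (h : ∀ a, N.Answers (env z.Y z.Y_nonempty a) (z.ans (env z.Y z.Y_nonempty a))) :
    ∃ Γ : CompTree U, Γ.SolvesDet z ∧ Γ.paths = N.paths := by
  have hp : (⟨z.Y, z.Y_nonempty, 0, fun _ => N⟩ : CompTree U).paths = N.paths := by
    simp [CompTree.paths, List.finRange_succ]
  refine ⟨⟨z.Y, z.Y_nonempty, 0, fun _ => N⟩, ⟨⟨rfl, fun _ => hN⟩, ?_⟩, hp⟩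
  rw [CompTree.solvesNondet_iff, hp]
  exact ⟨rfl, h⟩

/-- A deterministic tree whose paths have at most `m` working nodes has at most `2 ^ m`
complete paths. -/
theorem Node.IsDet.length_paths_le {N : Node U} (hN : N.IsDet) {m : ℕ}
    (h : ∀ ξ ∈ N.paths, ξ.steps.length ≤ m) : N.paths.length ≤ 2 ^ m := by
  induction N generalizing m with
  | terminal v => simp [Node.paths, Nat.one_le_two_pow]
  | func e k child ih =>
    obtain ⟨rfl, hc⟩ := hN
    simp only [Node.paths, List.finRange_succ, List.flatMap_cons] at h ⊢
    simp only [List.finRange_zero, List.map_nil, List.flatMap_nil, List.append_nil,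
      List.length_map, List.mem_map, forall_exists_index, and_imp, forall_apply_eq_imp_iff₂] at h ⊢
    exact ih 0 (hc 0) fun ξ hξ => (Nat.le_succ _).trans (h ξ hξ)
  | pred e k label child ih =>
    obtain ⟨hl, hc⟩ := hN
    have hk : k + 1 ≤ 2 := by simpa using Fintype.card_le_of_injective _ hl
    simp only [Node.paths, List.mem_flatMap, List.mem_map, List.mem_finRange, true_and,
      forall_exists_index, and_imp] at h
    cases m with
    | zero =>
      -- Any path through this predicate node has at least one step, so with the bound zero there
      -- are no paths at all.
      have : ∀ i, (child i).paths = [] := by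
        intro i
        rw [List.eq_nil_iff_forall_not_mem]
        intro ξ hξ
        have := h _ i ξ hξ rfl
        simp [Path.cons] at this
      simp [Node.paths, this]
    | succ m =>
      have hi : ∀ i, (child i).paths.length ≤ 2 ^ m := fun i => ih i (hc i) fun ξ hξ => by
        have := h _ i ξ hξ rfl
        simpa [Path.cons] using this
      rw [Node.paths, List.length_flatMap]
      calc _ ≤ ((List.finRange (k + 1)).map fun _ => 2 ^ m).sum :=
            List.sum_le_sum fun i _ => by simpa using hi i
        _ = (k + 1) * 2 ^ m := by simp
        _ ≤ 2 * 2 ^ m := Nat.mul_le_mul_right _ hk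
        _ = 2 ^ (m + 1) := by ring

end Semantics

/-! ### Estimates of the three complexity parameters -/

namespace SMPair

variable (S : SMPair.{u})

theorem treeCost_le {Γ : CompTree S.U} {c : ℕ} :
    S.treeCost Γ ≤ c ↔ ∀ ξ ∈ Γ.paths, S.seqCost ξ.β ≤ c := by
  rw [treeCost, Multiset.sup_le]
  simp

theorem exists_det (z : Problem S.U) (N : Node S.U) (hN : N.IsDet)
    (h : ∀ a, N.Answers (env z.Y z.Y_nonempty a) (z.ans (env z.Y z.Y_nonempty a))) {c : ℕ}
    (hc : ∀ ξ ∈ N.paths, S.seqCost ξ.β ≤ c) : ∃ Γ : CompTree S.U, Γ.SolvesDet z ∧ S.treeCost Γ ≤ c := by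
  obtain ⟨Γ, h1, h2⟩ := exists_tree_of_node z N hN h
  exact ⟨Γ, h1, S.treeCost_le.2 (h2 ▸ hc)⟩

theorem exists_det_le (z : Problem S.U) (E : List (Expr S.U)) (f : List Bool → ℕ)
    (h : ∀ a, f (evalPreds (env z.Y z.Y_nonempty a) E) ∈ z.ans (env z.Y z.Y_nonempty a)) :
    ∃ Γ : CompTree S.U, Γ.SolvesDet z ∧ S.treeCost Γ ≤ S.seqCost E :=
  S.exists_det z _ (isDet_complete E f) (fun a => answers_complete (h a)) fun ξ hξ => by
    rw [β_of_mem_complete hξ]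

theorem exists_det_le_i (z : Problem S.U) :
    ∃ Γ : CompTree S.U, Γ.SolvesDet z ∧ S.treeCost Γ ≤ S.seqCost z.β := by
  obtain ⟨f, hf⟩ := z.exists_answer_fun
  exact S.exists_det_le z z.β f fun a => hf _

/-- The infimum is attained because executing the description of `z` already gives a deterministic
solution; without that nonemptiness `sInf` would be a meaningless `0`. -/
theorem cost_d_le_iff (z : Problem S.U) (c : ℕ) : S.cost .d z ≤ c ↔
    ∃ Γ : CompTree S.U, Γ.SolvesDet z ∧ ∀ ξ ∈ Γ.paths, S.seqCost ξ.β ≤ c := by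
  simp only [← treeCost_le]
  constructor
  · intro h
    obtain ⟨Γ0, h0, -⟩ := S.exists_det_le_i z
    obtain ⟨Γ, h1, h2⟩ := Nat.sInf_mem (s := {c | ∃ Γ : CompTree S.U, Γ.SolvesDet z ∧
      S.treeCost Γ = c}) ⟨S.treeCost Γ0, Γ0, h0, rfl⟩
    exact ⟨Γ, h1, h2.le.trans h⟩
  · rintro ⟨Γ, h1, h2⟩
    have h3 : S.cost .d z ≤ S.treeCost Γ := Nat.sInf_le ⟨Γ, h1, rfl⟩
    exact h3.trans h2

theorem cost_a_le_iff (z : Problem S.U) (c : ℕ) : S.cost .a z ≤ c ↔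
    ∃ Ξ : List (Path S.U), PathsSolve Ξ z ∧ ∀ ξ ∈ Ξ, S.seqCost ξ.β ≤ c := by
  constructor
  · intro h
    obtain ⟨Γ0, h0, -⟩ := S.exists_det_le_i z
    obtain ⟨Γ, h1, h2⟩ := Nat.sInf_mem (s := {c | ∃ Γ : CompTree S.U, Γ.SolvesNondet z ∧
      S.treeCost Γ = c}) ⟨S.treeCost Γ0, Γ0, h0.2, rfl⟩
    exact ⟨Γ.paths, ((CompTree.solvesNondet_iff _ _).1 h1).2, S.treeCost_le.1 (h2.le.trans h)⟩
  · rintro ⟨Ξ, h1, h2⟩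
    -- Some input exists and must be covered, so the list of paths is nonempty and comes from a
    -- tree.
    obtain ⟨x⟩ := S.U.A_nonempty
    obtain ⟨ξ, hξ, -⟩ := (h1 fun _ => x).1
    obtain ⟨Γ, h3, rfl⟩ := exists_tree_of_paths z.Y z.Y_nonempty Ξ (List.ne_nil_of_mem hξ)
    have h4 : S.cost .a z ≤ S.treeCost Γ :=
      Nat.sInf_le ⟨Γ, (CompTree.solvesNondet_iff _ _).2 ⟨h3.symm, h1⟩, rfl⟩
    exact h4.trans (S.treeCost_le.2 h2)

theorem cost_d_le_of_list (z : Problem S.U) (E : List (Expr S.U)) (f : List Bool → ℕ)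
    (h : ∀ a, f (evalPreds (env z.Y z.Y_nonempty a) E) ∈ z.ans (env z.Y z.Y_nonempty a)) :
    S.cost .d z ≤ S.seqCost E := by
  obtain ⟨Γ, h1, h2⟩ := S.exists_det_le z E f h
  exact (S.cost_d_le_iff z _).2 ⟨Γ, h1, S.treeCost_le.1 h2⟩

/-- If the values of `E` determine an admissible answer of `z`, then `z` can be solved
deterministically by executing `E`. -/
theorem cost_d_le_of_determines (z : Problem S.U) (E : List (Expr S.U))
    (h : ∀ a, ∃ v, ∀ a', evalPreds (env z.Y z.Y_nonempty a') E =
      evalPreds (env z.Y z.Y_nonempty a) E → v ∈ z.ans (env z.Y z.Y_nonempty a')) :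
    S.cost .d z ≤ S.seqCost E := by
  classical
  choose g hg using h
  -- Answer as for an arbitrary input that produces the observed values. The default `0` is only for
  -- value lists that no input produces.
  refine S.cost_d_le_of_list z E (fun l => if h : ∃ a, evalPreds (env z.Y z.Y_nonempty a) E = l
    then g h.choose else 0) fun a => ?_
  have hex : ∃ a', evalPreds (env z.Y z.Y_nonempty a') E =
    evalPreds (env z.Y z.Y_nonempty a) E := ⟨a, rfl⟩
  rw [dif_pos hex]
  exact hg _ _ hex.choose_spec.symm

/-- Ask `e` first, and then execute `E b`, where `b` is the value of `e`. -/
theorem cost_d_le_of_branch (z : Problem S.U) (e : PredExpr S.U) (E : Bool → List (Expr S.U))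
    (h : ∀ a a', e.eval (env z.Y z.Y_nonempty a) = e.eval (env z.Y z.Y_nonempty a') →
      evalPreds (env z.Y z.Y_nonempty a) (E (e.eval (env z.Y z.Y_nonempty a))) =
        evalPreds (env z.Y z.Y_nonempty a') (E (e.eval (env z.Y z.Y_nonempty a))) →
      evalPreds (env z.Y z.Y_nonempty a) z.β = evalPreds (env z.Y z.Y_nonempty a') z.β)
    {c : ℕ} (hc : ∀ b, S.seqCost (.pred e :: E b) ≤ c) : S.cost .d z ≤ c := by
  classical
  obtain ⟨f, hf⟩ := z.exists_answer_fun
  -- Pick any input consistent with the value of `e` and with the subsequent values; by `h` it has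
  -- the same predicate values for `z`, hence shares a correct answer.
  let F : Bool → List Bool → ℕ := fun b l =>
    if h : ∃ a, e.eval (env z.Y z.Y_nonempty a) = b ∧
      evalPreds (env z.Y z.Y_nonempty a) (E b) = l
    then f (evalPreds (env z.Y z.Y_nonempty h.choose) z.β) else 0
  have hF : ∀ a, F (e.eval (env z.Y z.Y_nonempty a))
      (evalPreds (env z.Y z.Y_nonempty a) (E (e.eval (env z.Y z.Y_nonempty a)))) ∈
        z.ans (env z.Y z.Y_nonempty a) := by
    intro a
    have hex : ∃ a', e.eval (env z.Y z.Y_nonempty a') = e.eval (env z.Y z.Y_nonempty a) ∧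
        evalPreds (env z.Y z.Y_nonempty a') (E (e.eval (env z.Y z.Y_nonempty a))) =
          evalPreds (env z.Y z.Y_nonempty a) (E (e.eval (env z.Y z.Y_nonempty a))) :=
      ⟨a, rfl, rfl⟩
    simp only [F]
    rw [dif_pos hex, ← h a hex.choose hex.choose_spec.1.symm hex.choose_spec.2.symm]
    exact hf _
  obtain ⟨Γ, h1, h2⟩ := S.exists_det z (branch e fun b => complete (E b) (F b))
    (isDet_branch fun b => isDet_complete _ _) (c := c)
    (fun a => answers_branch (answers_complete (hF a))) (by
      intro ξ hξ
      obtain ⟨b, ξ', h', rfl⟩ := mem_paths_branch.1 hξ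
      have : (Path.cons (.pred e b) ξ').β = .pred e :: E b := by
        rw [← β_of_mem_complete h']; rfl
      rw [this]
      exact hc b)
  exact (S.cost_d_le_iff z _).2 ⟨Γ, h1, S.treeCost_le.1 h2⟩

theorem cost_a_le_d (z : Problem S.U) : S.cost .a z ≤ S.cost .d z := by
  obtain ⟨Γ, h1, h2⟩ := (S.cost_d_le_iff z _).1 le_rfl
  exact (S.cost_a_le_iff z _).2 ⟨_, ((CompTree.solvesNondet_iff _ _).1 h1.2).2, h2⟩

theorem cost_d_le_i (z : Problem S.U) : S.cost .d z ≤ S.cost .i z := by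
  obtain ⟨Γ, h1, h2⟩ := S.exists_det_le_i z
  exact (S.cost_d_le_iff z _).2 ⟨Γ, h1, S.treeCost_le.1 h2⟩

/-- A deterministic solution of cost at most `c` gives at most `2 ^ c` different answers if the
cost of a sequence is at least its length. -/
theorem card_le_two_pow (hS : ∀ w, w.length ≤ S.ψ w) {Y : Finset ℕ} {hY : Y.Nonempty}
    {β : List (Expr S.U)} {h : 0 < numPred β} (V : Finset (List Bool))
    (hV : ∀ v ∈ V, ∃ a, evalPreds (env Y hY a) β = v) :
    V.card ≤ 2 ^ S.cost .d (Problem.ofFun Y hY β h Encodable.encode) := by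
  classical
  obtain ⟨Γ, ⟨⟨hk, hdet⟩, hs⟩, h2⟩ := (S.cost_d_le_iff (Problem.ofFun Y hY β h Encodable.encode) _).1 le_rfl
  set c := S.cost .d (Problem.ofFun Y hY β h Encodable.encode)
  have hs' := ((CompTree.solvesNondet_iff _ _).1 hs).2
  obtain ⟨YΓ, hYΓ, k, child⟩ := Γ
  obtain rfl : k = 0 := hk
  have hp : (⟨YΓ, hYΓ, 0, child⟩ : CompTree S.U).paths = (child 0).paths := by
    simp [CompTree.paths, List.finRange_succ]
  rw [hp] at h2 hs'
  have hlen : (child 0).paths.length ≤ 2 ^ c := (hdet 0).length_paths_le fun ξ hξ => by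
    refine le_trans ?_ ((hS _).trans (h2 ξ hξ))
    simp [Path.β]
  -- The only correct answer is the code of the value list, so different lists need different
  -- terminal labels.
  have hsub : V.image Encodable.encode ⊆ ((child 0).paths.map Path.κ).toFinset := by
    intro x hx
    obtain ⟨v, hv, rfl⟩ := Finset.mem_image.1 hx
    obtain ⟨a, rfl⟩ := hV v hv
    obtain ⟨⟨ξ, hξ, ha⟩, h4⟩ := hs' a
    have := h4 ξ hξ ha
    rw [Problem.ans_ofFun, Finset.mem_singleton] at this
    simp only [List.mem_toFinset, List.mem_map]
    exact ⟨ξ, hξ, this⟩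
  calc V.card = (V.image Encodable.encode).card :=
        (Finset.card_image_of_injective _ Encodable.encode_injective).symm
    _ ≤ _ := Finset.card_le_card hsub
    _ ≤ _ := List.toFinset_card_le _
    _ ≤ _ := by simpa using hlen

/-- Every large value of the nondeterministic complexity is attained by a problem whose
description has the same complexity. -/
theorem exists_cost_a_eq_i (z : Problem S.U) (hz : S.ψ [] < S.cost .a z) :
    ∃ z' : Problem S.U, z'.Y = z.Y ∧ S.cost .a z' = S.cost .a z ∧ S.cost .i z' = S.cost .a z := by
  classical
  obtain ⟨Ξ, h1, h2⟩ := (S.cost_a_le_iff z _).1 le_rfl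
  set c := S.cost .a z
  by_contra hcon
  push Not at hcon
  -- If `a = c` for such a problem, then also `i = c` because `a ≤ i ≤ c`, and it would be the
  -- required problem.
  have hsmall : ∀ z' : Problem S.U, z'.Y = z.Y → S.cost .i z' ≤ c → S.cost .a z' ≤ c - 1 := by
    intro z' hY hi
    have h3 := (S.cost_a_le_d z').trans (S.cost_d_le_i z')
    by_contra h4
    exact hcon z' hY (by omega) (by omega)
  -- The path is replaced by finitely many cheaper paths with the same answer that together accept
  -- exactly the same inputs.
  have key : ∀ ξ : Path S.U, S.seqCost ξ.β ≤ c → ∃ L : List (Path S.U),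
      (∀ ξ' ∈ L, ξ'.κ = ξ.κ ∧ S.seqCost ξ'.β ≤ c - 1) ∧
      ∀ a, ((∃ ξ' ∈ L, ξ'.Accepts (env z.Y z.Y_nonempty a)) ↔
        ξ.Accepts (env z.Y z.Y_nonempty a)) := by
    intro ξ hξ
    rcases Nat.eq_zero_or_pos (numPred ξ.β) with h0 | h0
    -- A path without predicates accepts everything, and the empty path does the same at cost `S.ψ
    -- [] < c`; this is where `hz` is used.
    · refine ⟨[⟨[], ξ.κ⟩], ?_, fun a => ?_⟩
      · intro ξ' h'
        obtain rfl : ξ' = ⟨[], ξ.κ⟩ := by simpa using h'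
        exact ⟨rfl, by simp only [seqCost, Path.β, List.map_nil]; omega⟩
      · have e1 : evalPreds (env z.Y z.Y_nonempty a) ξ.β = [] := by
          rw [← List.length_eq_zero_iff, length_evalPreds, h0]
        have e2 : ξ.δ = [] := by rw [← List.length_eq_zero_iff, ξ.length_δ, h0]
        simp only [Path.Accepts, e1, e2, iff_true]
        exact ⟨⟨[], ξ.κ⟩, by simp, rfl⟩
    · obtain ⟨L, hL, hLc⟩ := (S.cost_a_le_iff _ _).1
        (hsmall (Problem.ofFun z.Y z.Y_nonempty ξ.β h0 Encodable.encode) rfl hξ)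
      -- In a cheap solution of the problem of computing the predicate values along `ξ`, keep the
      -- paths that report the labels of `ξ` and give them the answer of `ξ`.
      refine ⟨(L.filter fun ξ' => ξ'.κ = Encodable.encode ξ.δ).map fun ξ' => ⟨ξ'.steps, ξ.κ⟩, ?_,
        fun a => ⟨?_, ?_⟩⟩
      · intro ξ' h'
        obtain ⟨ξ'', h3, rfl⟩ := List.mem_map.1 h'
        exact ⟨rfl, hLc ξ'' (List.mem_filter.1 h3).1⟩
      · rintro ⟨ξ', h', ha⟩
        obtain ⟨ξ'', h3, rfl⟩ := List.mem_map.1 h'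
        obtain ⟨h4, h5⟩ := List.mem_filter.1 h3
        have h6 := (hL a).2 ξ'' h4 ha
        rw [Problem.ans_ofFun, Finset.mem_singleton] at h6
        have h7 : ξ''.κ = Encodable.encode ξ.δ := by simpa using h5
        exact Encodable.encode_injective (h6.symm.trans h7)
      · intro ha
        obtain ⟨ξ', h3, h4⟩ := (hL a).1
        have h6 := (hL a).2 ξ' h3 h4
        rw [Problem.ans_ofFun, Finset.mem_singleton] at h6
        refine ⟨⟨ξ'.steps, ξ.κ⟩, List.mem_map.2 ⟨ξ', List.mem_filter.2 ⟨h3, ?_⟩, rfl⟩, h4⟩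
        have h8 : evalPreds (env z.Y z.Y_nonempty a) ξ.β = ξ.δ := ha
        have h7 : ξ'.κ = Encodable.encode ξ.δ := by
          rw [← h8]; exact h6
        simpa using h7
  have key' : ∀ ξ : Path S.U, ∃ L : List (Path S.U), S.seqCost ξ.β ≤ c →
      (∀ ξ' ∈ L, ξ'.κ = ξ.κ ∧ S.seqCost ξ'.β ≤ c - 1) ∧
      ∀ a, ((∃ ξ' ∈ L, ξ'.Accepts (env z.Y z.Y_nonempty a)) ↔
        ξ.Accepts (env z.Y z.Y_nonempty a)) := fun ξ => by
    by_cases h : S.seqCost ξ.β ≤ c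
    · exact (key ξ h).imp fun L hL _ => hL
    · exact ⟨[], fun h' => absurd h' h⟩
  choose L hL using key'
  have : c ≤ c - 1 := (S.cost_a_le_iff z _).2 ⟨Ξ.flatMap L, fun a => ⟨?_, ?_⟩, ?_⟩
  · omega
  · obtain ⟨ξ, hξ, ha⟩ := (h1 a).1
    obtain ⟨ξ', h3, h4⟩ := ((hL ξ (h2 ξ hξ)).2 a).2 ha
    exact ⟨ξ', List.mem_flatMap.2 ⟨ξ, hξ, h3⟩, h4⟩
  · intro ξ' h' ha
    obtain ⟨ξ, hξ, h3⟩ := List.mem_flatMap.1 h'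
    rw [((hL ξ (h2 ξ hξ)).1 ξ' h3).1]
    exact (h1 a).2 ξ hξ (((hL ξ (h2 ξ hξ)).2 a).1 ⟨ξ', h3, ha⟩)
  · intro ξ' h'
    obtain ⟨ξ, hξ, h3⟩ := List.mem_flatMap.1 h'
    exact ((hL ξ (h2 ξ hξ)).1 ξ' h3).2

end SMPair

/-! ### Adding an input variable -/

section Embedding

variable {U : Struc.{u}}

/-- All variables that are read by the expression have indices less than `N`. -/
def Expr.ReadsBelow (N : ℕ) : Expr U → Prop
  | .func e => ∀ l, e.args l < N
  | .pred e => ∀ l, e.args l < N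

theorem exists_readsBelow (β : List (Expr U)) : ∃ N, ∀ M ≥ N, ∀ e ∈ β, e.ReadsBelow M := by
  have h1 : ∀ (n : ℕ) (f : Fin n → ℕ), ∃ N, ∀ M ≥ N, ∀ l, f l < M := fun n f => by
    refine ⟨Finset.univ.sup f + 1, fun M hM l => ?_⟩
    have := Finset.le_sup (f := f) (Finset.mem_univ l)
    omega
  induction β with
  | nil => exact ⟨0, by simp⟩
  | cons e β ih =>
    obtain ⟨N, hN⟩ := ih
    obtain ⟨K, hK⟩ : ∃ K, ∀ M ≥ K, e.ReadsBelow M := by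
      cases e with
      | func e => exact h1 _ e.args
      | pred e => exact h1 _ e.args
    refine ⟨max N K, fun M hM e' he' => ?_⟩
    rcases List.mem_cons.1 he' with rfl | he'
    · exact hK M (le_of_max_le_right hM)
    · exact hN M (le_of_max_le_left hM) e' he'

/-- The variable `v` may be assigned but is never read, so a difference at `v` never spreads to
another variable or to a predicate. -/
theorem evalPreds_congr {v : ℕ} {β : List (Expr U)} (hβ : ∀ e ∈ β, e.ReadsBelow v)
    {s s' : ℕ → U.A} (h : ∀ j, j ≠ v → s j = s' j) : evalPreds s β = evalPreds s' β := by
  induction β generalizing s s' with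
  | nil => rfl
  | cons e β ih =>
    have he := hβ e (by simp)
    have hβ' : ∀ e ∈ β, e.ReadsBelow v := fun e' h' => hβ e' (by simp [h'])
    cases e with
    | func e =>
      have hargs : (fun l => s (e.args l)) = fun l => s' (e.args l) :=
        funext fun l => h _ (he l).ne
      simp only [evalPreds, hargs]
      refine ih hβ' fun j hj => ?_
      by_cases hjt : j = e.target
      · subst hjt; simp
      · simp [hjt, h j hj]
    | pred e =>
      have hargs : (fun l => s (e.args l)) = fun l => s' (e.args l) :=
        funext fun l => h _ (he l).ne
      simp only [evalPreds, PredExpr.eval, hargs, ih hβ' h]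

/-- The new input gets the largest index precisely so that the default contents of non-input
variables stay unchanged. -/
theorem min'_insert_of_lt {Y : Finset ℕ} (hY : Y.Nonempty) {v : ℕ} (hv : ∀ j ∈ Y, j < v) : (insert v Y).min' (Finset.insert_nonempty v Y) = Y.min' hY := by
  apply le_antisymm
  · exact Finset.min'_le _ _ (Finset.mem_insert_of_mem (Finset.min'_mem _ _))
  · refine Finset.le_min' _ _ _ fun j hj => ?_
    rcases Finset.mem_insert.1 hj with rfl | hj
    · exact (hv _ (Finset.min'_mem _ _)).le
    · exact Finset.min'_le _ _ hj

theorem env_insert {Y : Finset ℕ} (hY : Y.Nonempty) {v : ℕ} (hv : ∀ j ∈ Y, j < v)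
    (a : ↥(insert v Y) → U.A) (j : ℕ) (hj : j ≠ v) :
    env (insert v Y) (Finset.insert_nonempty v Y) a j =
      env Y hY (fun i => a ⟨i.1, Finset.mem_insert_of_mem i.2⟩) j := by
  by_cases h : j ∈ Y
  · simp [env, initTerms, h]
  · simp [env, initTerms, h, hj, min'_insert_of_lt hY hv]

/-- Give the new input the default value that `v` would hold anyway. Since the contents agree at `v`
too, this works also for trees that read `v`. -/
theorem exists_env_insert {Y : Finset ℕ} (hY : Y.Nonempty) {v : ℕ} (hv : ∀ j ∈ Y, j < v)
    (a : Y → U.A) : ∃ a' : ↥(insert v Y) → U.A,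
    env (insert v Y) (Finset.insert_nonempty v Y) a' = env Y hY a := by
  refine ⟨fun i => env Y hY a i.1, ?_⟩
  funext j
  by_cases h : j ∈ Y
  · simp [env, initTerms, h]
  · have h0 := Finset.min'_mem Y hY
    by_cases h' : j = v
    · subst h'; simp [env, initTerms, h]
    · simp [env, initTerms, h, h', min'_insert_of_lt hY hv]

end Embedding

namespace SMPair

/-- Adding an input variable that does not occur in `z` and in optimal trees for `z` does not
change the complexity. -/
theorem exists_problem_succ (S : SMPair.{u}) (z : Problem S.U) :
    ∃ z' : Problem S.U, z'.Y.card = z.Y.card + 1 ∧ ∀ b, S.cost b z' = S.cost b z := by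
  obtain ⟨Γ, hΓ, hΓc⟩ := (S.cost_d_le_iff z _).1 le_rfl
  obtain ⟨Ξ, hΞ, hΞc⟩ := (S.cost_a_le_iff z _).1 le_rfl
  obtain ⟨N, hN⟩ := exists_readsBelow
    (z.β ++ (Γ.paths.flatMap Path.β ++ Ξ.flatMap Path.β))
  -- Above `z.Y`, to keep the minimum index, and above every index read by `z` or by the two optimal
  -- solutions.
  obtain ⟨v, hvY, hvN⟩ : ∃ v, (∀ j ∈ z.Y, j < v) ∧ N ≤ v :=
    ⟨max (z.Y.sup id + 1) N, fun j hj => by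
      have := Finset.le_sup (f := id) hj
      simp only [id] at this
      omega, le_max_right _ _⟩
  have hN := hN v hvN
  simp only [List.mem_append, List.mem_flatMap] at hN
  have hzv : ∀ e ∈ z.β, e.ReadsBelow v := fun e he => hN e (Or.inl he)
  let z' : Problem S.U := ⟨insert v z.Y, Finset.insert_nonempty v z.Y, z.β, z.r_pos, z.ν⟩
  have hY : v ∉ z.Y := fun h => (hvY v h).ne rfl
  have hans : ∀ s, z'.ans s = z.ans s := fun s => rfl
  have up : ∀ Ξ : List (Path S.U), (∀ ξ ∈ Ξ, ∀ e ∈ ξ.β, e.ReadsBelow v) → PathsSolve Ξ z →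
      PathsSolve Ξ z' := by
    intro Ξ h1 h2 a
    have hs := fun j hj => env_insert (U := S.U) z.Y_nonempty hvY a j hj
    have hacc : ∀ ξ ∈ Ξ, (ξ.Accepts (env z'.Y z'.Y_nonempty a) ↔
        ξ.Accepts (env z.Y z.Y_nonempty fun i => a ⟨i.1, Finset.mem_insert_of_mem i.2⟩)) := by
      intro ξ hξ
      rw [Path.Accepts, Path.Accepts, evalPreds_congr (h1 ξ hξ) hs]
    have hans' : z'.ans (env z'.Y z'.Y_nonempty a) =
        z.ans (env z.Y z.Y_nonempty fun i => a ⟨i.1, Finset.mem_insert_of_mem i.2⟩) := by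
      rw [hans]; exact z.ans_congr (evalPreds_congr hzv hs)
    obtain ⟨⟨ξ, h3, h4⟩, h5⟩ := h2 fun i => a ⟨i.1, Finset.mem_insert_of_mem i.2⟩
    refine ⟨⟨ξ, h3, (hacc ξ h3).2 h4⟩, fun ξ h6 h7 => ?_⟩
    rw [hans']
    exact h5 ξ h6 ((hacc ξ h6).1 h7)
  -- No restriction on the variables read is needed here: every input of `z` is literally simulated
  -- by an input of `z'`.
  have down : ∀ Ξ : List (Path S.U), PathsSolve Ξ z' → PathsSolve Ξ z := by
    intro Ξ h a
    obtain ⟨a', ha'⟩ := exists_env_insert (U := S.U) z.Y_nonempty hvY a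
    have := h a'
    simp only [hans] at this
    rw [show env z'.Y z'.Y_nonempty a' = env z.Y z.Y_nonempty a from ha'] at this
    exact this
  refine ⟨z', Finset.card_insert_of_notMem hY, fun b => ?_⟩
  cases b with
  | i => rfl
  | d =>
    apply le_antisymm
    · refine (S.cost_d_le_iff _ _).2 ⟨⟨insert v z.Y, Finset.insert_nonempty v z.Y, Γ.k, Γ.child⟩,
        ⟨hΓ.1, (CompTree.solvesNondet_iff _ _).2 ⟨rfl, up Γ.paths ?_ ?_⟩⟩, hΓc⟩
      · exact fun ξ hξ e he => hN e (Or.inr (Or.inl ⟨ξ, hξ, he⟩))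
      · exact ((CompTree.solvesNondet_iff _ _).1 hΓ.2).2
    · obtain ⟨Γ', h1, h2⟩ := (S.cost_d_le_iff z' _).1 le_rfl
      exact (S.cost_d_le_iff _ _).2 ⟨⟨z.Y, z.Y_nonempty, Γ'.k, Γ'.child⟩,
        ⟨h1.1, (CompTree.solvesNondet_iff _ _).2
          ⟨rfl, down Γ'.paths ((CompTree.solvesNondet_iff _ _).1 h1.2).2⟩⟩, h2⟩
  | a =>
    apply le_antisymm
    · exact (S.cost_a_le_iff _ _).2 ⟨Ξ, up Ξ
        (fun ξ hξ e he => hN e (Or.inr (Or.inr ⟨ξ, hξ, he⟩))) hΞ, hΞc⟩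
    · obtain ⟨Ξ', h1, h2⟩ := (S.cost_a_le_iff z' _).1 le_rfl
      exact (S.cost_a_le_iff _ _).2 ⟨Ξ', down Ξ' h1, h2⟩

end SMPair

end SMPairs

namespace SMPairs

/-! ### Types of the functions `𝒰` and `ℒ` -/

section Types

variable {X : Type*} {p : X → Prop} {f g : X → ℕ}

/-- The function `m ↦ max {f x : g x ≤ m}`. -/
noncomputable def upFun (p : X → Prop) (f g : X → ℕ) : ℕ →. ℕ := fun m =>
  maxPart {k | ∃ x, p x ∧ g x ≤ m ∧ f x = k}

/-- The function `m ↦ min {f x : g x ≥ m}`. -/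
noncomputable def loFun (p : X → Prop) (f g : X → ℕ) : ℕ →. ℕ := fun m =>
  minPart {k | ∃ x, p x ∧ m ≤ g x ∧ f x = k}

theorem mem_maxPart {s : Set ℕ} {k : ℕ} : k ∈ maxPart s ↔ IsGreatest s k := by
  constructor
  · rintro ⟨h, rfl⟩; exact h.choose_spec
  · intro h
    have h' : ∃ k, IsGreatest s k := ⟨k, h⟩
    exact ⟨h', h'.choose_spec.unique h⟩

theorem mem_minPart {s : Set ℕ} {k : ℕ} : k ∈ minPart s ↔ IsLeast s k := by
  constructor
  · rintro ⟨h, rfl⟩; exact h.choose_spec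
  · intro h
    have h' : ∃ k, IsLeast s k := ⟨k, h⟩
    exact ⟨h', h'.choose_spec.unique h⟩

theorem mem_upFun {m k : ℕ} : k ∈ upFun p f g m ↔
    (∃ x, p x ∧ g x ≤ m ∧ f x = k) ∧ ∀ x, p x → g x ≤ m → f x ≤ k := by
  rw [upFun, mem_maxPart, IsGreatest, mem_upperBounds]
  simp only [Set.mem_ofPred_eq, forall_exists_index, and_imp]
  exact and_congr_right fun _ => ⟨fun h x h1 h2 => h _ x h1 h2 rfl,
    fun h _ x h1 h2 h3 => h3 ▸ h x h1 h2⟩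

theorem mem_loFun {m k : ℕ} : k ∈ loFun p f g m ↔
    (∃ x, p x ∧ m ≤ g x ∧ f x = k) ∧ ∀ x, p x → m ≤ g x → k ≤ f x := by
  rw [loFun, mem_minPart, IsLeast, mem_lowerBounds]
  simp only [Set.mem_ofPred_eq, forall_exists_index, and_imp]
  exact and_congr_right fun _ => ⟨fun h x h1 h2 => h _ x h1 h2 rfl,
    fun h _ x h1 h2 h3 => h3 ▸ h x h1 h2⟩

theorem exists_mem_upFun {m c : ℕ} {x : X} (hx : p x) (hm : g x ≤ m)
    (hc : ∀ x, p x → g x ≤ m → f x ≤ c) : ∃ k, k ∈ upFun p f g m ∧ f x ≤ k ∧ k ≤ c := by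
  have hb : BddAbove {k | ∃ x, p x ∧ g x ≤ m ∧ f x = k} :=
    ⟨c, by rintro k ⟨x, h1, h2, rfl⟩; exact hc x h1 h2⟩
  have hn : {k | ∃ x, p x ∧ g x ≤ m ∧ f x = k}.Nonempty := ⟨f x, x, hx, hm, rfl⟩
  have h1 := Nat.sSup_mem hn hb
  refine ⟨_, mem_maxPart.2 ⟨h1, fun k hk => le_csSup hb hk⟩, le_csSup hb ⟨x, hx, hm, rfl⟩, ?_⟩
  obtain ⟨x, h2, h3, h4⟩ := h1
  exact h4 ▸ hc x h2 h3

theorem exists_mem_loFun {m : ℕ} {x : X} (hx : p x) (hm : m ≤ g x) :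
    ∃ k, k ∈ loFun p f g m ∧ k ≤ f x := by
  have hn : {k | ∃ x, p x ∧ m ≤ g x ∧ f x = k}.Nonempty := ⟨f x, x, hx, hm, rfl⟩
  exact ⟨_, mem_minPart.2 ⟨Nat.sInf_mem hn, fun k hk => Nat.sInf_le hk⟩,
    Nat.sInf_le ⟨x, hx, hm, rfl⟩⟩

theorem mem_dom_of_mem {h : ℕ →. ℕ} {m k : ℕ} (hk : k ∈ h m) : m ∈ h.Dom :=
  (PFun.mem_dom _ _).2 ⟨k, hk⟩

theorem infinite_of_forall_ge {s : Set ℕ} (h : ∀ m, ∃ k ∈ s, m ≤ k) : s.Infinite := by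
  rw [Set.infinite_iff_exists_gt]
  intro m
  obtain ⟨k, h1, h2⟩ := h (m + 1)
  exact ⟨k, h1, h2⟩

theorem finite_of_forall_le {s : Set ℕ} {c : ℕ} (h : ∀ k ∈ s, k ≤ c) : s.Finite :=
  (Set.finite_Iic c).subset h

theorem typ_up_alpha {c : ℕ} (hp : ∃ x, p x) (hf : ∀ x, p x → f x ≤ c) :
    typ (upFun p f g) = .α := by
  obtain ⟨x, hx⟩ := hp
  rw [typ_eq_iff]
  refine ⟨infinite_of_forall_ge fun m => ⟨max m (g x), ?_, le_max_left _ _⟩, c, fun m k hk => ?_⟩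
  · obtain ⟨k, h1, -⟩ := exists_mem_upFun (f := f) hx (le_max_right m (g x)) fun x h _ => hf x h
    exact mem_dom_of_mem h1
  · obtain ⟨⟨x, h1, -, h3⟩, -⟩ := mem_upFun.1 hk
    exact h3 ▸ hf x h1

theorem typ_lo_epsilon {c : ℕ} (hg : ∀ x, p x → g x ≤ c) : typ (loFun p f g) = .ε := by
  rw [typ_eq_iff]
  refine finite_of_forall_le (c := c) fun m hm => ?_
  obtain ⟨k, hk⟩ := (PFun.mem_dom _ _).1 hm
  obtain ⟨⟨x, h1, h2, -⟩, -⟩ := mem_loFun.1 hk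
  exact h2.trans (hg x h1)

theorem typ_up_epsilon {c : ℕ} (hf : ∀ m, ∃ x, p x ∧ g x ≤ c ∧ m ≤ f x) :
    typ (upFun p f g) = .ε := by
  rw [typ_eq_iff]
  refine finite_of_forall_le (c := c) fun m hm => ?_
  obtain ⟨k, hk⟩ := (PFun.mem_dom _ _).1 hm
  by_contra hcm
  obtain ⟨x, h1, h2, h3⟩ := hf (k + 1)
  have := (mem_upFun.1 hk).2 x h1 (by omega)
  omega

theorem typ_lo_alpha {c : ℕ} (h : ∀ m, ∃ x, p x ∧ f x ≤ c ∧ m ≤ g x) :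
    typ (loFun p f g) = .α := by
  rw [typ_eq_iff]
  refine ⟨infinite_of_forall_ge fun m => ⟨m, ?_, le_rfl⟩, c, fun m k hk => ?_⟩
  · obtain ⟨x, h1, -, h3⟩ := h m
    obtain ⟨k, h4, -⟩ := exists_mem_loFun (f := f) h1 h3
    exact mem_dom_of_mem h4
  · obtain ⟨x, h1, h2, h3⟩ := h m
    exact ((mem_loFun.1 hk).2 x h1 h3).trans h2

theorem le_of_mem_lo (hfg : ∀ x, p x → g x ≤ f x) {m k : ℕ} (hk : k ∈ loFun p f g m) : m ≤ k := by
  obtain ⟨⟨x, h1, h2, rfl⟩, -⟩ := mem_loFun.1 hk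
  exact h2.trans (hfg x h1)

/-- At the argument `g x` of a coincidence `f x = g x` the maximum equals the argument, which puts
it into both `domPlus` and `domMinus`. -/
theorem typ_up_gamma (hfg : ∀ x, p x → f x ≤ g x)
    (he : ∀ m, ∃ x, p x ∧ f x = g x ∧ m ≤ g x) : typ (upFun p f g) = .γ := by
  rw [typ_eq_iff]
  have key : ∀ m, ∃ k, m ≤ k ∧ k ∈ upFun p f g k := fun m => by
    obtain ⟨x, h1, h2, h3⟩ := he m
    obtain ⟨k, h4, h5, h6⟩ := exists_mem_upFun (f := f) h1 le_rfl
      (fun y hy hyx => (hfg y hy).trans hyx)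
    exact ⟨g x, h3, by rwa [show k = g x by omega] at h4⟩
  constructor <;>
  · refine infinite_of_forall_ge fun m => ?_
    obtain ⟨k, h1, h2⟩ := key m
    exact ⟨k, ⟨k, h2, le_rfl⟩, h1⟩

/-- A value at least `m` at the argument `m` comes from some `x` with `m ≤ f x ≤ g x ≤ m`, a
coincidence; so `domPlus` is bounded by `c`. -/
theorem typ_up_beta {c : ℕ} (hfg : ∀ x, p x → f x ≤ g x) (hf : ∀ m, ∃ x, p x ∧ m ≤ f x)
    (he : ∀ x, p x → f x = g x → g x ≤ c) : typ (upFun p f g) = .β := by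
  rw [typ_eq_iff]
  obtain ⟨x0, h0, -⟩ := hf 0
  have hdom : ∀ x, p x → ∃ k, k ∈ upFun p f g (g x) ∧ f x ≤ k := fun x hx => by
    obtain ⟨k, h4, h5, -⟩ := exists_mem_upFun (f := f) hx le_rfl
      (fun y hy hyx => (hfg y hy).trans hyx)
    exact ⟨k, h4, h5⟩
  refine ⟨infinite_of_forall_ge fun m => ?_, finite_of_forall_le (c := c) ?_, ?_⟩
  · obtain ⟨x, h1, h2⟩ := hf m
    obtain ⟨k, h3, -⟩ := hdom x h1
    exact ⟨g x, mem_dom_of_mem h3, h2.trans (hfg x h1)⟩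
  · rintro m ⟨k, h1, h2⟩
    obtain ⟨⟨x, h3, h4, rfl⟩, -⟩ := mem_upFun.1 h1
    have := hfg x h3
    have := he x h3 (by omega)
    omega
  · rintro ⟨b, hb⟩
    obtain ⟨x, h1, h2⟩ := hf (b + 1)
    obtain ⟨k, h3, h4⟩ := hdom x h1
    have := hb _ _ h3
    omega

theorem typ_lo_gamma (hfg : ∀ x, p x → g x ≤ f x)
    (he : ∀ m, ∃ x, p x ∧ f x = g x ∧ m ≤ g x) : typ (loFun p f g) = .γ := by
  rw [typ_eq_iff]
  have key : ∀ m, ∃ k, m ≤ k ∧ k ∈ loFun p f g k := fun m => by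
    obtain ⟨x, h1, h2, h3⟩ := he m
    obtain ⟨k, h4, h5⟩ := exists_mem_loFun (f := f) h1 (le_refl (g x))
    have := le_of_mem_lo hfg h4
    exact ⟨g x, h3, by rwa [show k = g x by omega] at h4⟩
  constructor <;>
  · refine infinite_of_forall_ge fun m => ?_
    obtain ⟨k, h1, h2⟩ := key m
    exact ⟨k, ⟨k, h2, le_rfl⟩, h1⟩

theorem typ_lo_delta {c : ℕ} (hfg : ∀ x, p x → g x ≤ f x) (hg : ∀ m, ∃ x, p x ∧ m ≤ g x)
    (he : ∀ x, p x → f x = g x → g x ≤ c) : typ (loFun p f g) = .δ := by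
  rw [typ_eq_iff]
  refine ⟨infinite_of_forall_ge fun m => ?_, finite_of_forall_le (c := c) ?_⟩
  · obtain ⟨x, h1, h2⟩ := hg m
    obtain ⟨k, h3, -⟩ := exists_mem_loFun (f := f) h1 h2
    exact ⟨m, mem_dom_of_mem h3, le_rfl⟩
  · rintro m ⟨k, h1, h2⟩
    obtain ⟨⟨x, h3, h4, rfl⟩, -⟩ := mem_loFun.1 h1
    have := hfg x h3
    have := he x h3 (by omega)
    omega

/-! In the following lemmas `f` and `g` are equal infinitely often, and `f` is bounded on each
set `{g ≤ m}`. -/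

theorem exists_mem_up_of_le
    (he : ∀ m, ∃ x, p x ∧ f x = g x ∧ m ≤ g x)
    (hb : ∀ m, ∃ c, ∀ x, p x → g x ≤ m → f x ≤ c) :
    ∃ m₀, ∀ m ≥ m₀, ∃ k, k ∈ upFun p f g m := by
  obtain ⟨x, h1, -, -⟩ := he 0
  refine ⟨g x, fun m hm => ?_⟩
  obtain ⟨c, hc⟩ := hb m
  obtain ⟨k, hk, -⟩ := exists_mem_upFun (f := f) h1 hm hc
  exact ⟨k, hk⟩

/-- Coincidences supply `domPlus`, the bounds `k` that carry over from `g` to `f` supply `domMinus`,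
and `hb` makes the maxima exist. -/
theorem typ_up_gamma_of_ge
    (he : ∀ m, ∃ x, p x ∧ f x = g x ∧ m ≤ g x)
    (hb : ∀ m, ∃ c, ∀ x, p x → g x ≤ m → f x ≤ c)
    (hw : ∀ m, ∃ k ≥ m, ∀ x, p x → g x ≤ k → f x ≤ k) : typ (upFun p f g) = .γ := by
  rw [typ_eq_iff]
  constructor
  · refine infinite_of_forall_ge fun m => ?_
    obtain ⟨x, h1, h2, h3⟩ := he m
    obtain ⟨c, hc⟩ := hb (g x)
    obtain ⟨k, h4, h5, -⟩ := exists_mem_upFun (f := f) h1 le_rfl hc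
    exact ⟨g x, ⟨k, h4, h2 ▸ h5⟩, h3⟩
  · refine infinite_of_forall_ge fun m => ?_
    obtain ⟨m₀, h0⟩ := exists_mem_up_of_le he hb
    obtain ⟨k, h1, h2⟩ := hw (max m m₀)
    obtain ⟨v, hv⟩ := h0 k (le_of_max_le_right h1)
    obtain ⟨⟨x, h3, h4, rfl⟩, -⟩ := mem_upFun.1 hv
    exact ⟨k, ⟨_, hv, h2 x h3 h4⟩, le_of_max_le_left h1⟩

theorem typ_up_delta_of_ge
    (he : ∀ m, ∃ x, p x ∧ f x = g x ∧ m ≤ g x)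
    (hb : ∀ m, ∃ c, ∀ x, p x → g x ≤ m → f x ≤ c)
    (hw : ∃ c, ∀ m ≥ c, ∃ x, p x ∧ g x ≤ m ∧ m < f x) : typ (upFun p f g) = .δ := by
  rw [typ_eq_iff]
  obtain ⟨m₀, h0⟩ := exists_mem_up_of_le he hb
  obtain ⟨c, hc⟩ := hw
  refine ⟨infinite_of_forall_ge fun m => ?_, finite_of_forall_le (c := c) ?_⟩
  · obtain ⟨k, hk⟩ := h0 _ (le_max_right m m₀)
    exact ⟨_, mem_dom_of_mem hk, le_max_left _ _⟩
  · rintro m ⟨k, h1, h2⟩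
    by_contra hm
    obtain ⟨x, h3, h4, h5⟩ := hc m (by omega)
    have := (mem_upFun.1 h1).2 x h3 h4
    omega

theorem exists_mem_lo_of_le
    (he : ∀ m, ∃ x, p x ∧ f x = g x ∧ m ≤ g x) (m : ℕ) : ∃ k, k ∈ loFun p g f m := by
  obtain ⟨x, h1, h2, h3⟩ := he m
  obtain ⟨k, hk, -⟩ := exists_mem_loFun (f := g) h1 (h2 ▸ h3 : m ≤ f x)
  exact ⟨k, hk⟩

theorem typ_lo_gamma_of_ge
    (he : ∀ m, ∃ x, p x ∧ f x = g x ∧ m ≤ g x)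
    (hw : ∀ m, ∃ k ≥ m, ∀ x, p x → g x ≤ k → f x ≤ k) : typ (loFun p g f) = .γ := by
  rw [typ_eq_iff]
  constructor
  · refine infinite_of_forall_ge fun m => ?_
    obtain ⟨k, h1, h2⟩ := hw m
    -- Since `g x ≤ k` forces `f x ≤ k`, reaching `f x ≥ k + 1` needs `g x ≥ k + 1`.
    obtain ⟨v, hv⟩ := exists_mem_lo_of_le he (k + 1)
    obtain ⟨⟨x, h3, h4, rfl⟩, -⟩ := mem_loFun.1 hv
    refine ⟨k + 1, ⟨_, hv, ?_⟩, by omega⟩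
    by_contra h5
    have := h2 x h3 (by omega)
    omega
  · refine infinite_of_forall_ge fun m => ?_
    obtain ⟨x, h1, h2, h3⟩ := he m
    obtain ⟨k, h4, h5⟩ := exists_mem_loFun (f := g) h1 (le_refl (f x))
    exact ⟨f x, ⟨k, h4, h2 ▸ h5⟩, h2 ▸ h3⟩

theorem typ_lo_beta_of_ge
    (he : ∀ m, ∃ x, p x ∧ f x = g x ∧ m ≤ g x)
    (hb : ∀ m, ∃ c, ∀ x, p x → g x ≤ m → f x ≤ c)
    (hw : ∃ c, ∀ m ≥ c, ∃ x, p x ∧ g x ≤ m ∧ m < f x) : typ (loFun p g f) = .β := by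
  rw [typ_eq_iff]
  obtain ⟨c, hc⟩ := hw
  refine ⟨infinite_of_forall_ge fun m => ?_, finite_of_forall_le (c := c) ?_, ?_⟩
  · obtain ⟨k, hk⟩ := exists_mem_lo_of_le he m
    exact ⟨m, mem_dom_of_mem hk, le_rfl⟩
  · rintro m ⟨k, h1, h2⟩
    by_contra hm
    -- The bound `m - 1` gives `g x ≤ m - 1` and `f x ≥ m`, so the minimum at `m` is strictly below
    -- `m`.
    obtain ⟨x, h3, h4, h5⟩ := hc (m - 1) (by omega)
    have := (mem_loFun.1 h1).2 x h3 (by omega)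
    omega
  · rintro ⟨b, hb'⟩
    obtain ⟨c', hc'⟩ := hb b
    obtain ⟨v, hv⟩ := exists_mem_lo_of_le he (c' + 1)
    have h1 := hb' _ _ hv
    obtain ⟨⟨x, h3, h4, rfl⟩, -⟩ := mem_loFun.1 hv
    have := hc' x h3 h1
    omega

end Types

end SMPairs

namespace SMPairs

namespace SMPair

variable (S : SMPair.{u}) (n : ℕ)

/-! ### The conditions that determine the `n`-type -/

/-- The parameter `b` is unbounded on problems with `n` input variables. -/
def Unb (b : Par) : Prop := ∀ m, ∃ z : Problem S.U, z.Y.card = n ∧ m ≤ S.cost b z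

/-- The parameters `i` and `d` take the same value for problems of arbitrarily large
complexity. -/
def EqInf : Prop :=
  ∀ m, ∃ z : Problem S.U, z.Y.card = n ∧ S.cost .d z = S.cost .i z ∧ m ≤ S.cost .i z

/-- The parameter `d` is unbounded on problems with bounded parameter `a`. -/
def DetUnb : Prop :=
  ∃ c, ∀ m, ∃ z : Problem S.U, z.Y.card = n ∧ S.cost .a z ≤ c ∧ m ≤ S.cost .d z

/-- Each large number separates the parameters `a` and `d` of some problem. -/
def Gap : Prop :=
  ∃ c, ∀ m ≥ c, ∃ z : Problem S.U, z.Y.card = n ∧ S.cost .a z ≤ m ∧ m < S.cost .d z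

variable {S n}

theorem not_unb {b : Par} (h : ¬ S.Unb n b) :
    ∃ c, ∀ z : Problem S.U, z.Y.card = n → S.cost b z ≤ c := by
  simp only [Unb, not_forall, not_exists, not_and, not_le] at h
  obtain ⟨m, hm⟩ := h
  exact ⟨m, fun z hz => (hm z hz).le⟩

theorem not_eqInf (h : ¬ S.EqInf n) :
    ∃ c, ∀ z : Problem S.U, z.Y.card = n → S.cost .d z = S.cost .i z → S.cost .i z ≤ c := by
  simp only [EqInf, not_forall, not_exists, not_and, not_le] at h
  obtain ⟨m, hm⟩ := h
  exact ⟨m, fun z hz h' => (hm z hz h').le⟩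

theorem not_detUnb (h : ¬ S.DetUnb n) (m : ℕ) :
    ∃ c, ∀ z : Problem S.U, z.Y.card = n → S.cost .a z ≤ m → S.cost .d z ≤ c := by
  simp only [DetUnb, not_forall, not_exists, not_and, not_le] at h
  obtain ⟨c, hc⟩ := h m
  exact ⟨c, fun z hz h' => (hc z hz h').le⟩

theorem not_gap (h : ¬ S.Gap n) (m : ℕ) :
    ∃ k ≥ m, ∀ z : Problem S.U, z.Y.card = n → S.cost .a z ≤ k → S.cost .d z ≤ k := by
  simp only [Gap, not_forall, not_exists, not_and, not_lt] at h
  obtain ⟨k, hk, h'⟩ := h m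
  exact ⟨k, hk, h'⟩

/-- All monotone conditions speak only of the three costs of a single problem, so one transfer
statement serves them all. -/
theorem exists_card_succ (P : (Par → ℕ) → Prop)
    (h : ∃ z : Problem S.U, z.Y.card = n ∧ P fun b => S.cost b z) :
    ∃ z : Problem S.U, z.Y.card = n + 1 ∧ P fun b => S.cost b z := by
  obtain ⟨z, rfl, hz⟩ := h
  obtain ⟨z', h1, h2⟩ := S.exists_problem_succ z
  exact ⟨z', h1, by simpa only [h2] using hz⟩

theorem Unb.succ {b : Par} (h : S.Unb n b) : S.Unb (n + 1) b := fun m =>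
  exists_card_succ (fun v => m ≤ v b) (h m)

theorem EqInf.succ (h : S.EqInf n) : S.EqInf (n + 1) := fun m =>
  exists_card_succ (fun v => v .d = v .i ∧ m ≤ v .i) (h m)

theorem DetUnb.succ (h : S.DetUnb n) : S.DetUnb (n + 1) := by
  obtain ⟨c, hc⟩ := h
  exact ⟨c, fun m => exists_card_succ (fun v => v .a ≤ c ∧ m ≤ v .d) (hc m)⟩

theorem Gap.succ (h : S.Gap n) : S.Gap (n + 1) := by
  obtain ⟨c, hc⟩ := h
  exact ⟨c, fun m hm => exists_card_succ (fun v => v .a ≤ m ∧ m < v .d) (hc m hm)⟩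

/-- The parameter `i` ignores the input variables, so they can be replaced by any others. -/
theorem unb_i_iff {n' : ℕ} (hn : 0 < n) (h : S.Unb n' .i) : S.Unb n .i := fun m => by
  obtain ⟨z, -, hz⟩ := h m
  have hY : (Finset.range n).Nonempty := by simpa using hn.ne'
  exact ⟨⟨Finset.range n, hY, z.β, z.r_pos, z.ν⟩, Finset.card_range n, hz⟩

theorem Unb.d_of_a (h : S.Unb n .a) : S.Unb n .d := fun m => by
  obtain ⟨z, h1, h2⟩ := h m
  exact ⟨z, h1, h2.trans (S.cost_a_le_d z)⟩

theorem EqInf.unb_d (h : S.EqInf n) : S.Unb n .d := fun m => by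
  obtain ⟨z, h1, h2, h3⟩ := h m
  exact ⟨z, h1, h2 ▸ h3⟩

theorem DetUnb.unb_d (h : S.DetUnb n) : S.Unb n .d := fun m => by
  obtain ⟨c, hc⟩ := h
  obtain ⟨z, h1, -, h3⟩ := hc m
  exact ⟨z, h1, h3⟩

theorem detUnb_of_unb (hd : S.Unb n .d) (ha : ¬ S.Unb n .a) : S.DetUnb n := by
  obtain ⟨c, hc⟩ := not_unb ha
  refine ⟨c, fun m => ?_⟩
  obtain ⟨z, h1, h2⟩ := hd m
  exact ⟨z, h1, hc z h1, h2⟩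

variable (S) in
theorem exists_problem (hn : 0 < n) : ∃ z : Problem S.U, z.Y.card = n := by
  obtain ⟨p, hp⟩ := S.U.P_nonempty
  have hY : (Finset.range n).Nonempty := by simpa using hn.ne'
  exact ⟨Problem.ofFun (Finset.range n) hY [.pred ⟨⟨p, hp⟩, fun _ => 0⟩] Nat.one_pos fun _ => 0,
    Finset.card_range n⟩

/-- Keep an expensive description but make the answer constant: no expression has to be executed.
This forces the upper type `ε` in the first row and the lower type `α` in the first column, off the
diagonal. -/
theorem exists_const (hi : S.Unb n .i) (m : ℕ) :
    ∃ z : Problem S.U, z.Y.card = n ∧ S.cost .d z ≤ S.ψ [] ∧ m ≤ S.cost .i z := by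
  obtain ⟨z, h1, h2⟩ := hi m
  refine ⟨Problem.ofFun z.Y z.Y_nonempty z.β z.r_pos fun _ => 0, h1, ?_, h2⟩
  exact S.cost_d_le_of_list _ [] (fun _ => 0) fun a => by simp [Problem.ans_ofFun]

theorem exists_eq_of_unb_a (h : S.Unb n .a) (m : ℕ) : ∃ z : Problem S.U, z.Y.card = n ∧
    S.cost .a z = S.cost .i z ∧ S.cost .d z = S.cost .i z ∧ m ≤ S.cost .i z := by
  -- The second term meets the hypothesis of `exists_cost_a_eq_i`; then `a ≤ d ≤ i` squeezes `d` as
  -- well.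
  obtain ⟨z, h1, h2⟩ := h (max m (S.ψ [] + 1))
  obtain ⟨z', h3, h4, h5⟩ := S.exists_cost_a_eq_i z (by omega)
  have h6 := S.cost_a_le_d z'
  have h7 := S.cost_d_le_i z'
  exact ⟨z', h3 ▸ h1, by omega, by omega, by omega⟩

/-! ### Computation of the `n`-type -/

theorem nTyp_ext {T : Table} (h : ∀ b c,
    typ (loFun (fun z : Problem S.U => z.Y.card = n) (S.cost b) (S.cost c)) = (T b c).1 ∧
    typ (upFun (fun z : Problem S.U => z.Y.card = n) (S.cost b) (S.cost c)) = (T b c).2) :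
    S.nTyp n = T := by
  funext b c
  exact Prod.ext (h b c).1 (h b c).2

theorem nTyp_eq_T1 (hn : 0 < n) (hi : ¬ S.Unb n .i) : S.nTyp n = T1 := by
  obtain ⟨c, hc⟩ := not_unb hi
  have hall : ∀ b, ∀ z : Problem S.U, z.Y.card = n → S.cost b z ≤ c := by
    intro b z hz
    have h1 := S.cost_a_le_d z
    have h2 := S.cost_d_le_i z
    have h3 := hc z hz
    cases b <;> omega
  have hp := S.exists_problem hn
  apply nTyp_ext
  rintro (_ | _ | _) (_ | _ | _) <;>
    exact ⟨typ_lo_epsilon (hall _), typ_up_alpha hp (hall _)⟩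

section

variable (hi : S.Unb n .i)
include hi

theorem typ_lo_ii : typ (loFun (fun z : Problem S.U => z.Y.card = n) (S.cost .i) (S.cost .i)) = .γ :=
  typ_lo_gamma (fun _ _ => le_rfl) fun m => (hi m).imp fun _ h => ⟨h.1, rfl, h.2⟩

theorem typ_up_ii : typ (upFun (fun z : Problem S.U => z.Y.card = n) (S.cost .i) (S.cost .i)) = .γ :=
  typ_up_gamma (fun _ _ => le_rfl) fun m => (hi m).imp fun _ h => ⟨h.1, rfl, h.2⟩

theorem typ_up_id : typ (upFun (fun z : Problem S.U => z.Y.card = n) (S.cost .i) (S.cost .d)) = .ε :=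
  typ_up_epsilon (c := S.ψ []) fun m => exists_const hi m

theorem typ_up_ia : typ (upFun (fun z : Problem S.U => z.Y.card = n) (S.cost .i) (S.cost .a)) = .ε :=
  typ_up_epsilon (c := S.ψ []) fun m => (exists_const hi m).imp fun z h =>
    ⟨h.1, (S.cost_a_le_d z).trans h.2.1, h.2.2⟩

theorem typ_lo_di : typ (loFun (fun z : Problem S.U => z.Y.card = n) (S.cost .d) (S.cost .i)) = .α :=
  typ_lo_alpha (c := S.ψ []) fun m => exists_const hi m

theorem typ_lo_ai : typ (loFun (fun z : Problem S.U => z.Y.card = n) (S.cost .a) (S.cost .i)) = .α :=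
  typ_lo_alpha (c := S.ψ []) fun m => (exists_const hi m).imp fun z h =>
    ⟨h.1, (S.cost_a_le_d z).trans h.2.1, h.2.2⟩

end

theorem cost_d_le_i' (z : Problem S.U) (_ : z.Y.card = n) : S.cost .d z ≤ S.cost .i z :=
  S.cost_d_le_i z

theorem cost_a_le_d' (z : Problem S.U) (_ : z.Y.card = n) : S.cost .a z ≤ S.cost .d z :=
  S.cost_a_le_d z

theorem cost_a_le_i' (z : Problem S.U) (_ : z.Y.card = n) : S.cost .a z ≤ S.cost .i z :=
  (S.cost_a_le_d z).trans (S.cost_d_le_i z)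

theorem nTyp_eq_T2 (hn : 0 < n) (hi : S.Unb n .i) (hd : ¬ S.Unb n .d) : S.nTyp n = T2 := by
  obtain ⟨c, hc⟩ := not_unb hd
  have hc' : ∀ z : Problem S.U, z.Y.card = n → S.cost .a z ≤ c := fun z hz =>
    (S.cost_a_le_d z).trans (hc z hz)
  have hp := S.exists_problem hn
  apply nTyp_ext
  rintro (_ | _ | _) (_ | _ | _)
  · exact ⟨typ_lo_ii hi, typ_up_ii hi⟩
  · exact ⟨typ_lo_epsilon hc, typ_up_id hi⟩
  · exact ⟨typ_lo_epsilon hc', typ_up_ia hi⟩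
  · exact ⟨typ_lo_di hi, typ_up_alpha hp hc⟩
  · exact ⟨typ_lo_epsilon hc, typ_up_alpha hp hc⟩
  · exact ⟨typ_lo_epsilon hc', typ_up_alpha hp hc⟩
  · exact ⟨typ_lo_ai hi, typ_up_alpha hp hc'⟩
  · exact ⟨typ_lo_epsilon hc, typ_up_alpha hp hc'⟩
  · exact ⟨typ_lo_epsilon hc', typ_up_alpha hp hc'⟩

theorem Unb.i_of_d (h : S.Unb n .d) : S.Unb n .i := fun m =>
  (h m).imp fun z hz => ⟨hz.1, hz.2.trans (S.cost_d_le_i z)⟩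

/-- With coincidences of `d` and `i` bounded, the functions that compare them stay strictly off the
diagonal from some point on; this is the only difference from `T4`. -/
theorem nTyp_eq_T3 (hn : 0 < n) (hd : S.Unb n .d) (ha : ¬ S.Unb n .a) (he : ¬ S.EqInf n) :
    S.nTyp n = T3 := by
  have hi := hd.i_of_d
  obtain ⟨c, hc⟩ := not_unb ha
  have hp := S.exists_problem hn
  obtain ⟨e, he⟩ := not_eqInf he
  apply nTyp_ext
  rintro (_ | _ | _) (_ | _ | _)
  · exact ⟨typ_lo_ii hi, typ_up_ii hi⟩
  · refine ⟨typ_lo_delta (c := e) cost_d_le_i' hd fun z h1 h2 => ?_, typ_up_id hi⟩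
    exact h2 ▸ he z h1 h2.symm
  · exact ⟨typ_lo_epsilon hc, typ_up_ia hi⟩
  · exact ⟨typ_lo_di hi, typ_up_beta cost_d_le_i' hd he⟩
  · exact ⟨typ_lo_gamma (fun _ _ => le_rfl) fun m => (hd m).imp fun _ h => ⟨h.1, rfl, h.2⟩,
      typ_up_gamma (fun _ _ => le_rfl) fun m => (hd m).imp fun _ h => ⟨h.1, rfl, h.2⟩⟩
  · exact ⟨typ_lo_epsilon hc, typ_up_epsilon fun m => (hd m).imp fun z h => ⟨h.1, hc z h.1, h.2⟩⟩
  · exact ⟨typ_lo_ai hi, typ_up_alpha hp hc⟩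
  · exact ⟨typ_lo_alpha fun m => (hd m).imp fun z h => ⟨h.1, hc z h.1, h.2⟩, typ_up_alpha hp hc⟩
  · exact ⟨typ_lo_epsilon hc, typ_up_alpha hp hc⟩

theorem nTyp_eq_T4 (hn : 0 < n) (hd : S.Unb n .d) (ha : ¬ S.Unb n .a) (he : S.EqInf n) :
    S.nTyp n = T4 := by
  have hi := hd.i_of_d
  obtain ⟨c, hc⟩ := not_unb ha
  have hp := S.exists_problem hn
  have hid : ∀ m, ∃ z : Problem S.U, z.Y.card = n ∧ S.cost .i z = S.cost .d z ∧
      m ≤ S.cost .d z := fun m => (he m).imp fun z h => ⟨h.1, h.2.1.symm, h.2.2.trans h.2.1.ge⟩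
  apply nTyp_ext
  rintro (_ | _ | _) (_ | _ | _)
  · exact ⟨typ_lo_ii hi, typ_up_ii hi⟩
  · exact ⟨typ_lo_gamma cost_d_le_i' hid, typ_up_id hi⟩
  · exact ⟨typ_lo_epsilon hc, typ_up_ia hi⟩
  · exact ⟨typ_lo_di hi, typ_up_gamma cost_d_le_i' he⟩
  · exact ⟨typ_lo_gamma (fun _ _ => le_rfl) fun m => (hd m).imp fun _ h => ⟨h.1, rfl, h.2⟩,
      typ_up_gamma (fun _ _ => le_rfl) fun m => (hd m).imp fun _ h => ⟨h.1, rfl, h.2⟩⟩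
  · exact ⟨typ_lo_epsilon hc, typ_up_epsilon fun m => (hd m).imp fun z h => ⟨h.1, hc z h.1, h.2⟩⟩
  · exact ⟨typ_lo_ai hi, typ_up_alpha hp hc⟩
  · exact ⟨typ_lo_alpha fun m => (hd m).imp fun z h => ⟨h.1, hc z h.1, h.2⟩, typ_up_alpha hp hc⟩
  · exact ⟨typ_lo_epsilon hc, typ_up_alpha hp hc⟩

/-- If the parameter `a` is unbounded, then only two entries of the table are not fixed. -/
theorem nTyp_eq_of_unb_a (ha : S.Unb n .a) {s t : Typ}
    (hs : typ (loFun (fun z : Problem S.U => z.Y.card = n) (S.cost .a) (S.cost .d)) = s)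
    (ht : typ (upFun (fun z : Problem S.U => z.Y.card = n) (S.cost .d) (S.cost .a)) = t) :
    S.nTyp n = triple
      (triple (.γ, .γ) (.γ, .ε) (.γ, .ε))
      (triple (.α, .γ) (.γ, .γ) (.γ, t))
      (triple (.α, .γ) (s, .γ) (.γ, .γ)) := by
  have hd := ha.d_of_a
  have hi := hd.i_of_d
  have he := exists_eq_of_unb_a ha
  have hdi : ∀ m, ∃ z : Problem S.U, z.Y.card = n ∧ S.cost .d z = S.cost .i z ∧
      m ≤ S.cost .i z := fun m => (he m).imp fun z h => ⟨h.1, h.2.2⟩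
  have hid : ∀ m, ∃ z : Problem S.U, z.Y.card = n ∧ S.cost .i z = S.cost .d z ∧
      m ≤ S.cost .d z := fun m => (hdi m).imp fun z h => ⟨h.1, h.2.1.symm, h.2.2.trans h.2.1.ge⟩
  have hai : ∀ m, ∃ z : Problem S.U, z.Y.card = n ∧ S.cost .a z = S.cost .i z ∧
      m ≤ S.cost .i z := fun m => (he m).imp fun z h => ⟨h.1, h.2.1, h.2.2.2⟩
  have hia : ∀ m, ∃ z : Problem S.U, z.Y.card = n ∧ S.cost .i z = S.cost .a z ∧
      m ≤ S.cost .a z := fun m => (hai m).imp fun z h => ⟨h.1, h.2.1.symm, h.2.2.trans h.2.1.ge⟩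
  have had : ∀ m, ∃ z : Problem S.U, z.Y.card = n ∧ S.cost .a z = S.cost .d z ∧
      m ≤ S.cost .d z := fun m => (he m).imp fun z h => by
    obtain ⟨h1, h2, h3, h4⟩ := h; exact ⟨h1, by omega, by omega⟩
  have hda : ∀ m, ∃ z : Problem S.U, z.Y.card = n ∧ S.cost .d z = S.cost .a z ∧
      m ≤ S.cost .a z := fun m => (had m).imp fun z h => ⟨h.1, h.2.1.symm, h.2.2.trans h.2.1.ge⟩
  apply nTyp_ext
  rintro (_ | _ | _) (_ | _ | _)
  · exact ⟨typ_lo_ii hi, typ_up_ii hi⟩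
  · exact ⟨typ_lo_gamma cost_d_le_i' hid, typ_up_id hi⟩
  · exact ⟨typ_lo_gamma cost_a_le_i' hia, typ_up_ia hi⟩
  · exact ⟨typ_lo_di hi, typ_up_gamma cost_d_le_i' hdi⟩
  · exact ⟨typ_lo_gamma (fun _ _ => le_rfl) fun m => (hd m).imp fun _ h => ⟨h.1, rfl, h.2⟩,
      typ_up_gamma (fun _ _ => le_rfl) fun m => (hd m).imp fun _ h => ⟨h.1, rfl, h.2⟩⟩
  · exact ⟨typ_lo_gamma cost_a_le_d' hda, ht⟩
  · exact ⟨typ_lo_ai hi, typ_up_gamma cost_a_le_i' hai⟩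
  · exact ⟨hs, typ_up_gamma cost_a_le_d' had⟩
  · exact ⟨typ_lo_gamma (fun _ _ => le_rfl) fun m => (ha m).imp fun _ h => ⟨h.1, rfl, h.2⟩,
      typ_up_gamma (fun _ _ => le_rfl) fun m => (ha m).imp fun _ h => ⟨h.1, rfl, h.2⟩⟩

theorem exists_d_eq_a (ha : S.Unb n .a) (m : ℕ) : ∃ z : Problem S.U, z.Y.card = n ∧
    S.cost .d z = S.cost .a z ∧ m ≤ S.cost .a z := by
  obtain ⟨z, h1, h2, h3, h4⟩ := exists_eq_of_unb_a ha m
  exact ⟨z, h1, by omega, by omega⟩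

theorem nTyp_eq_T5 (ha : S.Unb n .a) (hv : ¬ S.DetUnb n) (hg : ¬ S.Gap n) : S.nTyp n = T5 :=
  nTyp_eq_of_unb_a ha
    (typ_lo_gamma_of_ge (exists_d_eq_a ha) (not_gap hg))
    (typ_up_gamma_of_ge (exists_d_eq_a ha) (not_detUnb hv) (not_gap hg))

theorem nTyp_eq_T6 (ha : S.Unb n .a) (hv : ¬ S.DetUnb n) (hg : S.Gap n) : S.nTyp n = T6 :=
  nTyp_eq_of_unb_a ha
    (typ_lo_beta_of_ge (exists_d_eq_a ha) (not_detUnb hv) hg)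
    (typ_up_delta_of_ge (exists_d_eq_a ha) (not_detUnb hv) hg)

theorem nTyp_eq_T7 (ha : S.Unb n .a) (hv : S.DetUnb n) : S.nTyp n = T7 := by
  obtain ⟨c, hc⟩ := hv
  exact nTyp_eq_of_unb_a ha (typ_lo_alpha hc) (typ_up_epsilon hc)

open Classical in
/-- The table determined by the conditions on `n`. -/
theorem nTyp_eq (hn : 0 < n) : S.nTyp n =
    if S.Unb n .i then if S.Unb n .d then if S.Unb n .a then
      if S.DetUnb n then T7 else if S.Gap n then T6 else T5
      else if S.EqInf n then T4 else T3 else T2 else T1 := by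
  split_ifs with h1 h2 h3 h4 h5 h4
  · exact nTyp_eq_T7 h3 h4
  · exact nTyp_eq_T6 h3 h4 h5
  · exact nTyp_eq_T5 h3 h4 h5
  · exact nTyp_eq_T4 hn h2 h3 h4
  · exact nTyp_eq_T3 hn h2 h3 h4
  · exact nTyp_eq_T2 hn h1 h2
  · exact nTyp_eq_T1 hn h1

end SMPair

/-! ### Dynamic types -/

theorem pow_append_apply (T : Table) (i : ℕ) (s : Stream' Table) (k : ℕ) :
    (pow T i ++ₛ s) k = if k < i then T else s (k - i) := by
  induction i generalizing k with
  | zero => rfl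
  | succ i ih =>
    cases k with
    | zero => rfl
    | succ k =>
      have : (pow T (i + 1) ++ₛ s) (k + 1) = (pow T i ++ₛ s) k := rfl
      rw [this, ih]
      simp

theorem inf_apply (T : Table) (k : ℕ) : inf T k = T := rfl

open Classical in
-- Encodes each persistent condition by one number, so that the dynamic type becomes a matter of
-- comparing thresholds.
theorem exists_first {P : ℕ → Prop} (hP : ∀ k, P k → P (k + 1)) :
    (∀ k, ¬ P k) ∨ ∃ g, ∀ k, P k ↔ g ≤ k := by
  by_cases h : ∃ k, P k
  · refine Or.inr ⟨Nat.find h, fun k => ⟨fun hk => Nat.find_min' h hk, fun hk => ?_⟩⟩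
    exact Nat.le_induction (Nat.find_spec h) (fun k _ => hP k) k hk
  · exact Or.inl fun k hk => h ⟨k, hk⟩

theorem SMPair.dtyp_apply (S : SMPair.{u}) (k : ℕ) : S.dtyp k = S.nTyp (k + 1) := rfl

/-- Let `d`, `a`, `e`, `v`, `g` be the thresholds of `Unb .d`, `Unb .a`, `EqInf`, `DetUnb`, `Gap`.
If `d < a`, then `DetUnb` already holds at `d`, so `T5` and `T6` cannot occur; if `d = a`, then `T3`
and `T4` cannot. -/
theorem SMPair.dtyp_mem (S : SMPair.{u}) : S.dtyp ∈ ({inf T1} ∪ Delta : Set (Stream' Table)) := by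
  by_cases hi : S.Unb 1 .i
  swap
  · left
    funext k
    exact SMPair.nTyp_eq_T1 k.succ_pos fun h => hi (SMPair.unb_i_iff one_pos h)
  right
  have hi' : ∀ k, S.Unb (k + 1) .i := fun k => SMPair.unb_i_iff k.succ_pos hi
  have hT : ∀ k, S.dtyp k = _ := fun k => SMPair.nTyp_eq (S := S) k.succ_pos
  simp only [hi', if_true] at hT
  have hda : ∀ k, S.Unb (k + 1) .a → S.Unb (k + 1) .d := fun k => SMPair.Unb.d_of_a
  have hev : ∀ k, S.Unb (k + 1) .d → ¬ S.Unb (k + 1) .a → S.DetUnb (k + 1) :=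
    fun k => SMPair.detUnb_of_unb
  have hed : ∀ k, S.EqInf (k + 1) → S.Unb (k + 1) .d := fun k => SMPair.EqInf.unb_d
  have hD := exists_first (P := fun k => S.Unb (k + 1) .d) fun k => SMPair.Unb.succ
  have hA := exists_first (P := fun k => S.Unb (k + 1) .a) fun k => SMPair.Unb.succ
  have hE := exists_first (P := fun k => S.EqInf (k + 1)) fun k => SMPair.EqInf.succ
  have hV := exists_first (P := fun k => S.DetUnb (k + 1)) fun k => SMPair.DetUnb.succ
  have hG := exists_first (P := fun k => S.Gap (k + 1)) fun k => SMPair.Gap.succ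
  simp only [Delta, List.append_assoc, Stream'.append_append_stream, Set.mem_union, Set.mem_singleton_iff,
    Set.mem_ofPred_eq]
  rcases hD with hD | ⟨d, hD⟩
  · simp only [hD, if_false] at hT
    exact .inl <| .inl <| .inl <| .inl <| .inl <| .inl <| funext hT
  simp only [hD] at hT hda hev hed
  rcases hA with hA | ⟨a, hA⟩
  · simp only [hA, if_false] at hT
    rcases hE with hE | ⟨e, hE⟩
    · refine .inl <| .inl <| .inl <| .inl <| .inl <| .inr ⟨d, funext fun k => ?_⟩
      simp only [hT, hE, pow_append_apply, inf_apply, if_false]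
      split_ifs <;> first | rfl | omega
    · refine .inl <| .inl <| .inl <| .inl <| .inr ⟨d, max e d - d, funext fun k => ?_⟩
      simp only [hT, hE, pow_append_apply, inf_apply]
      split_ifs <;> first | rfl | omega
  simp only [hA] at hT hda hev
  have hd : d ≤ a := hda a le_rfl
  rcases hd.lt_or_eq with hda' | rfl
  · have hV' : ∀ k, a ≤ k → S.DetUnb (k + 1) := by
      rcases hV with hV | ⟨v, hV⟩
      · exact absurd (hev d le_rfl (by omega)) (hV d)
      · intro k hk
        rw [hV]
        have := (hV d).1 (hev d le_rfl (by omega))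
        omega
    rcases hE with hE | ⟨e, hE⟩
    · refine .inl <| .inl <| .inl <| .inr ⟨d, a - d, 0, funext fun k => ?_⟩
      simp only [hT, hE, pow_append_apply, inf_apply, if_false]
      have := hV' k
      split_ifs <;> first | rfl | omega | exact absurd (this (by omega)) (by assumption)
    -- `T3` lasts until `EqInf` or `Unb .a` begins, and `T4` until `a`; truncated subtraction gives
    -- no `T4` when `EqInf` comes too late.
    · refine .inl <| .inl <| .inl <| .inr ⟨d, min (max e d) a - d, a - max e d, funext fun k => ?_⟩
      simp only [hT, hE, pow_append_apply, inf_apply]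
      have := hV' k
      split_ifs <;> first | rfl | omega | exact absurd (this (by omega)) (by assumption)
  · rcases hV with hV | ⟨v, hV⟩ <;> rcases hG with hG | ⟨g, hG⟩
    · refine .inl <| .inl <| .inr ⟨d, funext fun k => ?_⟩
      simp only [hT, hV, hG, pow_append_apply, inf_apply, if_false]
      split_ifs <;> first | rfl | omega
    · refine .inl <| .inr ⟨d, max g d - d, funext fun k => ?_⟩
      simp only [hT, hV, hG, pow_append_apply, inf_apply, if_false]
      split_ifs <;> first | rfl | omega
    · refine .inr ⟨d, max v d - d, 0, funext fun k => ?_⟩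
      simp only [hT, hV, hG, pow_append_apply, inf_apply, if_false]
      split_ifs <;> first | rfl | omega
    -- `T5` ends when `Gap` or `DetUnb` begins, and `T6` fills what remains before `DetUnb`.
    · refine .inr ⟨d, min (max g d) (max v d) - d, max v d - max g d, funext fun k => ?_⟩
      simp only [hT, hV, hG, pow_append_apply, inf_apply]
      split_ifs <;> first | rfl | omega

end SMPairs

namespace SMPairs

/-! ### Structures of threshold predicates with prescribed arities -/

namespace Gated

/-- The kinds of predicates: thresholds of weight zero, arbitrary sets of weight zero, thresholds
of weight `2 ^ t`, and thresholds of logarithmic weight. -/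
inductive Kind
  | light | sets | heavy | medium

theorem Kind.forall {P : Kind → Prop} (h1 : P .light) (h2 : P .sets) (h3 : P .heavy)
    (h4 : P .medium) (κ : Kind) : P κ := by cases κ <;> assumption

open Classical in
noncomputable instance : Fintype Kind :=
  ⟨{.light, .sets, .heavy, .medium}, fun κ => by cases κ <;> simp⟩

/-- The indices of the predicates of a given kind. -/
def Ix : Kind → Type
  | .sets => Set ℕ
  | .light => ℕ
  | .heavy => ℕ
  | .medium => ℕ

/-- The set of numbers that a predicate recognizes. -/
def set : (κ : Kind) → Ix κ → Set ℕ
  | .sets => fun S => S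
  | .light => fun t : ℕ => {v : ℕ | t ≤ v}
  | .heavy => fun t : ℕ => {v : ℕ | t ≤ v}
  | .medium => fun t : ℕ => {v : ℕ | t ≤ v}

/-- The weight of a predicate. -/
def weight : (κ : Kind) → Ix κ → ℕ
  | .sets => fun _ => 0
  | .light => fun _ => 0
  | .heavy => fun t : ℕ => 2 ^ t
  | .medium => fun t : ℕ => Nat.clog 2 t

/-- An element has a tag, a kind, and a value. -/
abbrev Carrier : Type := ℕ × Kind × ℕ

variable (G : Kind → ℕ∞)

/-- The arity of the predicates of a kind: one more than its gate. -/
def ar (κ : Kind) : ℕ := (G κ).toNat + 1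

/-- The value seen by the predicates of a kind: it exists if the arguments are pairwise different
and the first one has this kind. -/
noncomputable def seen (κ : Kind) (x : Fin (ar G κ) → Carrier) : Option ℕ :=
  open Classical in
  -- The gate `⊤` has `toNat` equal to `0`, hence arity one, so such a kind must be switched off
  -- explicitly.
  if G κ ≠ ⊤ ∧ Function.Injective x ∧ (x ⟨0, Nat.succ_pos _⟩).2.1 = κ
  then some (x ⟨0, Nat.succ_pos _⟩).2.2 else none

/-- The value exists and belongs to the set. -/
noncomputable def hits (o : Option ℕ) (S : Set ℕ) : Bool :=
  open Classical in decide (∃ v ∈ o, v ∈ S)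

theorem hits_iff {o : Option ℕ} {S : Set ℕ} : hits o S = true ↔ ∃ v ∈ o, v ∈ S := by simp [hits]

theorem hits_none (S : Set ℕ) : hits none S = false := by simp [hits]

/-- The symbol of a predicate. -/
noncomputable def sym (κ : Kind) (x : Ix κ) : Σ n : ℕ, (Fin n → Carrier) → Bool :=
  ⟨ar G κ, fun y => hits (seen G κ y) (set κ x)⟩

/-- The structure with all these predicates and without functions. -/
noncomputable abbrev struc : Struc.{0} where
  A := Carrier
  A_nonempty := ⟨(0, .light, 0)⟩
  F := ∅
  P := {p | ∃ κ x, sym G κ x = p}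
  P_nonempty := ⟨_, .light, (0 : ℕ), rfl⟩
  P_arity := by
    rintro p ⟨κ, x, rfl⟩
    exact Nat.succ_pos _

/-- The least weight of a predicate that the symbol denotes. -/
noncomputable def symWeight : (struc G).Symbol → ℕ
  | .inl _ => 0
  | .inr p => sInf {m | ∃ κ x, sym G κ x = p.1 ∧ weight κ x = m}

/-- The complexity of a word: the maximum of its length and of the weights of its letters. -/
noncomputable abbrev pair : SMPair.{0} where
  U := struc G
  ψ w := max w.length ((w.map (symWeight G)).foldr max 0)

/-- A predicate expression that is given by its predicate and its variables. -/
structure Query where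
  κ : Kind
  ix : Ix κ
  args : Fin (ar G κ) → ℕ

variable {G}

noncomputable def Query.predExpr (q : Query G) : PredExpr (pair G).U :=
  ⟨⟨sym G q.κ q.ix, q.κ, q.ix, rfl⟩, q.args⟩

noncomputable def Query.expr (q : Query G) : Expr (pair G).U := .pred q.predExpr

/-- The value of a query when the variables hold the values `s`. -/
noncomputable def Query.eval (q : Query G) (s : ℕ → (pair G).U.A) : Bool :=
  hits (seen G q.κ fun l => s (q.args l)) (set q.κ q.ix)

theorem evalPreds_map_expr (l : List (Query G)) (s : ℕ → (pair G).U.A) :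
    evalPreds s (l.map Query.expr) = l.map fun q => q.eval s := by
  induction l with
  | nil => rfl
  | cons q l ih =>
    simp only [List.map_cons, ← ih]
    rfl

theorem numPred_map_expr (l : List (Query G)) : numPred (l.map Query.expr) = l.length := by
  induction l with
  | nil => rfl
  | cons q l ih => rw [List.map_cons, numPred, List.countP_cons_of_pos rfl, List.length_cons, ← ih]; rfl

theorem ψ_le_iff (w : List (pair G).U.Symbol) (c : ℕ) :
    (pair G).ψ w ≤ c ↔ w.length ≤ c ∧ ∀ s ∈ w, symWeight G s ≤ c := by
  have : ∀ l : List ℕ, l.foldr max 0 ≤ c ↔ ∀ m ∈ l, m ≤ c := by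
    intro l
    induction l with
    | nil => simp
    | cons m l ih => simp [ih]
  rw [max_le_iff, this]
  exact and_congr_right fun _ => List.forall_mem_map

theorem length_le_ψ (w : List (pair G).U.Symbol) : w.length ≤ (pair G).ψ w := le_max_left _ _

theorem symWeight_le (q : Query G) : symWeight G q.expr.symbol ≤ weight q.κ q.ix :=
  Nat.sInf_le ⟨q.κ, q.ix, rfl, rfl⟩

theorem seqCost_map_expr_le {l : List (Query G)} {c : ℕ} (h1 : l.length ≤ c)
    (h2 : ∀ q ∈ l, weight q.κ q.ix ≤ c) : (pair G).seqCost (l.map Query.expr) ≤ c := by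
  rw [SMPair.seqCost, ψ_le_iff]
  refine ⟨by simpa using h1, ?_⟩
  simp only [List.mem_map]
  rintro s ⟨e, ⟨q, hq, rfl⟩, rfl⟩
  exact (symWeight_le q).trans (h2 q hq)

/-- Different indices may denote the same predicate; the index is chosen to attain the minimum that
defines the weight of the symbol. -/
theorem exists_query (e : Expr (pair G).U) :
    ∃ q : Query G, q.expr = e ∧ weight q.κ q.ix = symWeight G e.symbol := by
  cases e with
  | func e => exact absurd e.f.2 (Set.notMem_empty _)
  | pred e =>
    obtain ⟨⟨p, hp⟩, args⟩ := e
    obtain ⟨κ₀, x₀, h₀⟩ := hp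
    obtain ⟨κ, x, rfl, hm⟩ := Nat.sInf_mem (s := {m | ∃ κ x, sym G κ x = p ∧ weight κ x = m})
      ⟨_, κ₀, x₀, h₀, rfl⟩
    exact ⟨⟨κ, x, args⟩, rfl, hm⟩

/-- Every sequence of expressions consists of queries whose weights are bounded by its
complexity. -/
theorem exists_queries (β : List (Expr (pair G).U)) : ∃ l : List (Query G),
    l.map Query.expr = β ∧ l.length ≤ (pair G).seqCost β ∧
      ∀ q ∈ l, weight q.κ q.ix ≤ (pair G).seqCost β := by
  choose q hq hw using exists_query (G := G)
  refine ⟨β.map q, ?_, ?_, ?_⟩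
  · simp [hq, Function.comp_def]
  · simp [SMPair.seqCost]
  · intro x hx
    obtain ⟨e, he, rfl⟩ := List.mem_map.1 hx
    rw [hw]
    exact ((ψ_le_iff _ _).1 le_rfl).2 _ (List.mem_map_of_mem he)

/-! ### Normalized queries -/

/-- The input variable that gives the initial value of a variable. -/
def source {Y : Finset ℕ} (hY : Y.Nonempty) (j : ℕ) : Y :=
  if h : j ∈ Y then ⟨j, h⟩ else ⟨Y.min' hY, Y.min'_mem hY⟩

theorem env_eq {Y : Finset ℕ} (hY : Y.Nonempty) (a : Y → (pair G).U.A) :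
    env Y hY a = fun j => a (source hY j) := by
  funext j
  by_cases h : j ∈ Y <;> simp [env, initTerms, source, h]

theorem source_coe {Y : Finset ℕ} (hY : Y.Nonempty) (y : Y) : source hY y = y := by
  simp [source]

/-- The query with input variables as arguments. -/
def inputQuery {Y : Finset ℕ} (κ : Kind) (x : Ix κ) (t : Fin (ar G κ) → Y) : Query G :=
  ⟨κ, x, fun l => t l⟩

theorem eval_env (q : Query G) {Y : Finset ℕ} (hY : Y.Nonempty) (a : Y → (pair G).U.A) :
    q.eval (env Y hY a) =
      hits (seen G q.κ fun l => a (source hY (q.args l))) (set q.κ q.ix) := by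
  rw [env_eq]; rfl

theorem eval_inputQuery {Y : Finset ℕ} (hY : Y.Nonempty) (κ : Kind) (x : Ix κ)
    (t : Fin (ar G κ) → Y) (a : Y → (pair G).U.A) :
    (inputQuery κ x t).eval (env Y hY a) =
      hits (seen G κ fun l => a (t l)) (set κ x) := by
  rw [eval_env]
  simp only [inputQuery, source_coe]

/-- Predicates with more arguments than there are input variables are constant. -/
theorem seen_eq_none {Y : Finset ℕ} {κ : Kind} (h : (Y.card : ℕ∞) ≤ G κ)
    (t : Fin (ar G κ) → Y) (a : Y → (pair G).U.A) : seen G κ (fun l => a (t l)) = none := by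
  rw [seen, if_neg]
  rintro ⟨h1, h2, -⟩
  have h3 : Function.Injective t := fun l l' hl => h2 (by simp only [hl])
  have h4 : ar G κ ≤ Y.card := by simpa using Fintype.card_le_of_injective _ h3
  rw [← ENat.natCast_toNat h1, Nat.cast_le] at h
  have : ar G κ = (G κ).toNat + 1 := rfl
  omega

theorem eval_eq_false {q : Query G} {Y : Finset ℕ} (hY : Y.Nonempty) (h : (Y.card : ℕ∞) ≤ G q.κ)
    (a : Y → (pair G).U.A) : q.eval (env Y hY a) = false := by
  rw [eval_env, seen_eq_none h, hits_none]

/-! ### Upper bounds -/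

/-- The structure has no functions, so variables never change and acceptance depends only on the
values of the queries along the path. -/
theorem accepts_of_eval_eq {ξ : Path (pair G).U} {l : List (Query G)}
    (hl : l.map Query.expr = ξ.β) {s s' : ℕ → (pair G).U.A} (h : ∀ q ∈ l, q.eval s = q.eval s')
    (hξ : ξ.Accepts s) : ξ.Accepts s' := by
  rw [Path.Accepts, ← hl, evalPreds_map_expr] at hξ ⊢
  rw [← hξ]
  exact List.map_congr_left fun q hq => (h q hq).symm

/-- If only finitely many predicates of weight at most `m` are not constant, then they can all be
asked. -/
theorem cost_d_le_max (z : Problem (pair G).U) {m : ℕ} (J : Finset (Σ κ, Ix κ))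
    (hJ : ∀ κ x, weight κ x ≤ m → (z.Y.card : ℕ∞) ≤ G κ ∨ ⟨κ, x⟩ ∈ J)
    (hJm : ∀ i ∈ J, weight i.1 i.2 ≤ m) (hz : (pair G).cost .a z ≤ m) :
    (pair G).cost .d z ≤ max m (∑ i ∈ J, z.Y.card ^ ar G i.1) := by
  classical
  -- Every predicate of `J` on every tuple of input variables. Up to constant queries, these contain
  -- all queries of an optimal nondeterministic solution.
  let E : List (Query G) := J.toList.flatMap fun i =>
    (Finset.univ : Finset (Fin (ar G i.1) → z.Y)).toList.map (inputQuery i.1 i.2)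
  have hlen : E.length = ∑ i ∈ J, z.Y.card ^ ar G i.1 := by
    simp [E, List.length_flatMap, Finset.sum_map_toList]
  have hE : ∀ q ∈ E, weight q.κ q.ix ≤ m := by
    intro q hq
    simp only [E, List.mem_flatMap, Finset.mem_toList, List.mem_map, Finset.mem_univ,
      true_and] at hq
    obtain ⟨i, hi, t, rfl⟩ := hq
    exact hJm i hi
  refine le_trans (SMPair.cost_d_le_of_determines _ z (E.map Query.expr) fun a => ?_)
    (seqCost_map_expr_le (hlen ▸ le_max_right _ _) fun q hq => (hE q hq).trans (le_max_left _ _))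
  obtain ⟨Ξ, h1, h2⟩ := (SMPair.cost_a_le_iff _ z _).1 hz
  obtain ⟨ξ, hξ, ha⟩ := (h1 a).1
  refine ⟨ξ.κ, fun a' h' => (h1 a').2 ξ hξ ?_⟩
  obtain ⟨l, hl, -, hlw⟩ := exists_queries ξ.β
  refine accepts_of_eval_eq hl (fun q hq => ?_) ha
  rw [evalPreds_map_expr, evalPreds_map_expr, List.map_inj_left] at h'
  rcases hJ q.κ q.ix ((hlw q hq).trans (h2 ξ hξ)) with h3 | h3
  · rw [eval_eq_false z.Y_nonempty h3, eval_eq_false z.Y_nonempty h3]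
  · have h4 := h' (inputQuery q.κ q.ix fun l => source z.Y_nonempty (q.args l)) (by
      simp only [E, List.mem_flatMap, Finset.mem_toList, List.mem_map, Finset.mem_univ,
        true_and]
      exact ⟨_, h3, _, rfl⟩)
    rw [eval_inputQuery, eval_inputQuery] at h4
    rw [eval_env, eval_env]
    exact h4.symm

/-- If each input has a certificate from a finite set that determines the values of all predicate
expressions of the problem, then the nondeterministic complexity is bounded by the complexity of
the certificates. -/
theorem cost_a_le_of_certificates (z : Problem (pair G).U) {l : List (Query G)}
    (hl : l.map Query.expr = z.β) {c : ℕ} (T : Set (List (Query G))) (hT : T.Finite)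
    (hTc : ∀ s ∈ T, s.length ≤ c ∧ ∀ q ∈ s, weight q.κ q.ix ≤ c)
    (h : ∀ a, ∃ s ∈ T, ∀ a',
      (∀ q ∈ s, q.eval (env z.Y z.Y_nonempty a) = q.eval (env z.Y z.Y_nonempty a')) →
      ∀ q ∈ l, q.eval (env z.Y z.Y_nonempty a) =
        q.eval (env z.Y z.Y_nonempty a')) :
    (pair G).cost .a z ≤ c := by
  classical
  obtain ⟨f, hf⟩ := z.exists_answer_fun
  choose s hsT hs using h
  let P : List (Query G) × List Bool × List Bool → Path (pair G).U := fun x =>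
    ⟨(x.1.zip x.2.1).map fun y => .pred y.1.predExpr y.2, f x.2.2⟩
  -- A certificate, its values, and the values that determine the answer: only finitely many such
  -- triples arise, so finitely many paths suffice even though there are infinitely many inputs.
  let F : (z.Y → (pair G).U.A) → List (Query G) × List Bool × List Bool := fun a =>
    (s a, (s a).map fun q => q.eval (env z.Y z.Y_nonempty a),
      evalPreds (env z.Y z.Y_nonempty a) z.β)
  have hfin : (Set.range F).Finite := by
    refine (hT.prod ((List.finite_length_le Bool c).prod
      (List.finite_length_le Bool (numPred z.β)))).subset ?_
    rintro _ ⟨a, rfl⟩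
    refine ⟨hsT a, ?_, ?_⟩
    · simpa [F] using (hTc _ (hsT a)).1
    · simp [F, length_evalPreds]
  have hβ : ∀ a, (P (F a)).β = (s a).map Query.expr := by
    intro a
    simp only [P, F, Path.β, List.map_map, List.zip_map_right]
    apply List.ext_getElem <;> simp [Query.expr, Step.expr]
  have hδ : ∀ a, (P (F a)).δ = (s a).map fun q =>
      q.eval (env z.Y z.Y_nonempty a) := by
    intro a
    simp only [P, F, Path.δ, List.filterMap_map]
    rw [show (Step.label? ∘ fun y : Query G × Bool => Step.pred y.1.predExpr y.2) =
      some ∘ Prod.snd from rfl, List.filterMap_eq_map, List.map_snd_zip (by simp)]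
  have hacc : ∀ a a', (P (F a)).Accepts (env z.Y z.Y_nonempty a') ↔ ∀ q ∈ s a,
      q.eval (env z.Y z.Y_nonempty a) = q.eval (env z.Y z.Y_nonempty a') := by
    intro a a'
    rw [Path.Accepts, hβ, hδ, evalPreds_map_expr, List.map_inj_left]
    exact forall₂_congr fun q _ => eq_comm
  refine (SMPair.cost_a_le_iff _ z c).2 ⟨(hfin.image P).toFinset.toList, fun a => ⟨?_, ?_⟩, ?_⟩
  · exact ⟨P (F a), by simp, (hacc a a).2 fun _ _ => rfl⟩
  · simp only [Finset.mem_toList, Set.Finite.mem_toFinset, Set.mem_image, Set.mem_range]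
    rintro _ ⟨_, ⟨a', rfl⟩, rfl⟩ h'
    have h1 := hs a' a ((hacc a' a).1 h')
    have h2 : evalPreds (env z.Y z.Y_nonempty a') z.β = evalPreds (env z.Y z.Y_nonempty a) z.β := by
      rw [← hl, evalPreds_map_expr, evalPreds_map_expr]
      exact List.map_congr_left h1
    change f (evalPreds (env z.Y z.Y_nonempty a') z.β) ∈ _
    rw [h2]
    exact hf _
  · simp only [Finset.mem_toList, Set.Finite.mem_toFinset, Set.mem_image, Set.mem_range]
    rintro _ ⟨_, ⟨a', rfl⟩, rfl⟩
    rw [hβ]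
    exact seqCost_map_expr_le (hTc _ (hsT a')).1 (hTc _ (hsT a')).2

/-- Two thresholds determine the position of a value with respect to finitely many thresholds. -/
theorem exists_threshold_certificate (Z : Finset ℕ) (o : Option ℕ) : ∃ s ⊆ Z, s.card ≤ 2 ∧
    ∀ o', (∀ t ∈ s, hits o {v | t ≤ v} = hits o' {v | t ≤ v}) →
      ∀ t ∈ Z, hits o {v | t ≤ v} = hits o' {v | t ≤ v} := by
  classical
  have hmono : ∀ (o : Option ℕ) {t t' : ℕ}, t ≤ t' → hits o {v | t' ≤ v} = true →
      hits o {v | t ≤ v} = true := by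
    intro o t t' h h'
    obtain ⟨v, h1, h2⟩ := hits_iff.1 h'
    exact hits_iff.2 ⟨v, h1, h.trans h2⟩
  -- The largest threshold that is reached certifies all smaller ones; below, the smallest one that
  -- is missed refutes all larger ones.
  have hlow : ∃ s ⊆ Z, s.card ≤ 1 ∧ ∀ o', (∀ t ∈ s, hits o {v | t ≤ v} = hits o' {v | t ≤ v}) →
      ∀ t ∈ Z, hits o {v | t ≤ v} = true → hits o' {v | t ≤ v} = true := by
    rcases (Z.filter fun t => hits o {v | t ≤ v} = true).eq_empty_or_nonempty with h | h
    · refine ⟨∅, by simp, by simp, fun o' _ t ht h1 => ?_⟩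
      exact absurd (Finset.mem_filter.2 ⟨ht, h1⟩) (h ▸ Finset.notMem_empty t)
    · obtain ⟨t₀, h0, h1⟩ := Finset.exists_max_image _ (fun t => t) h
      obtain ⟨h2, h3⟩ := Finset.mem_filter.1 h0
      refine ⟨{t₀}, by simpa using h2, by simp, fun o' ho' t ht h4 => ?_⟩
      refine hmono o' (h1 t (Finset.mem_filter.2 ⟨ht, h4⟩)) ?_
      rw [← ho' t₀ (by simp)]
      exact h3
  have hupp : ∃ s ⊆ Z, s.card ≤ 1 ∧ ∀ o', (∀ t ∈ s, hits o {v | t ≤ v} = hits o' {v | t ≤ v}) →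
      ∀ t ∈ Z, hits o' {v | t ≤ v} = true → hits o {v | t ≤ v} = true := by
    rcases (Z.filter fun t => ¬ hits o {v | t ≤ v} = true).eq_empty_or_nonempty with h | h
    · refine ⟨∅, by simp, by simp, fun o' _ t ht _ => ?_⟩
      by_contra h1
      exact absurd (Finset.mem_filter.2 ⟨ht, h1⟩) (h ▸ Finset.notMem_empty t)
    · obtain ⟨t₀, h0, h1⟩ := Finset.exists_min_image _ (fun t => t) h
      obtain ⟨h2, h3⟩ := Finset.mem_filter.1 h0
      refine ⟨{t₀}, by simpa using h2, by simp, fun o' ho' t ht h4 => ?_⟩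
      by_contra h5
      refine h3 ?_
      rw [ho' t₀ (by simp)]
      exact hmono o' (h1 t (Finset.mem_filter.2 ⟨ht, h5⟩)) h4
  obtain ⟨s, h1, h2, h3⟩ := hlow
  obtain ⟨s', h1', h2', h3'⟩ := hupp
  refine ⟨s ∪ s', Finset.union_subset h1 h1', (Finset.card_union_le _ _).trans (by omega),
    fun o' ho' t ht => ?_⟩
  rw [Bool.eq_iff_iff]
  exact ⟨h3 o' (fun t ht => ho' t (Finset.mem_union_left _ ht)) t ht,
    h3' o' (fun t ht => ho' t (Finset.mem_union_right _ ht)) t ht⟩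

/-- One set determines the position of a value with respect to finitely many sets. -/
theorem exists_set_certificate (Z : Finset (Set ℕ)) : ∃ R : Set (Set ℕ), R.Finite ∧
    ∀ o, ∃ A ∈ R, ∀ o', hits o A = hits o' A → ∀ B ∈ Z, hits o B = hits o' B := by
  classical
  -- Atoms of the Boolean algebra generated by `Z` fix membership in all its sets at once. The full
  -- set is added to certify that no value is seen.
  let atom : Finset (Set ℕ) → Set ℕ := fun D => {v | ∀ B ∈ Z, v ∈ B ↔ B ∈ D}
  refine ⟨insert Set.univ (atom '' (Z.powerset : Set (Finset (Set ℕ)))),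
    ((Finset.finite_toSet _).image _).insert _, fun o => ?_⟩
  cases o with
  | none =>
    refine ⟨Set.univ, by simp, fun o' h B _ => ?_⟩
    cases o' with
    | none => rfl
    | some v => simp [hits] at h
  | some v =>
    refine ⟨atom (Z.filter fun B => v ∈ B), Or.inr ⟨_, Finset.mem_coe.2 (Finset.mem_powerset.2 (Finset.filter_subset _ _)), rfl⟩, fun o' h B hB => ?_⟩
    have h1 : hits (some v) (atom (Z.filter fun B => v ∈ B)) = true := by
      rw [hits_iff]
      refine ⟨v, rfl, fun B hB => ?_⟩
      simp [hB]
    rw [h1] at h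
    obtain ⟨v', rfl, h2⟩ := hits_iff.1 h.symm
    have h3 := h2 B hB
    rw [Finset.mem_filter] at h3
    rw [Bool.eq_iff_iff, hits_iff, hits_iff]
    simp only [Option.mem_def, Option.some.injEq, exists_eq_left']
    tauto

end Gated

end SMPairs

namespace SMPairs

/-! ### What fails while some gates are closed -/

namespace Gated

variable {G : Kind → ℕ∞}

-- With the weighted kinds closed, each kind needs at most two weight-zero queries for each tuple of
-- inputs to certify all values of `z`. The bound does not depend on how many predicates `z` has.
open Classical in
theorem cost_a_le (z : Problem (pair G).U) (hH : (z.Y.card : ℕ∞) ≤ G .heavy)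
    (hM : (z.Y.card : ℕ∞) ≤ G .medium) :
    (pair G).cost .a z ≤ 2 * ∑ κ, z.Y.card ^ ar G κ := by
  obtain ⟨l, hl, -, -⟩ := exists_queries z.β
  let Z : (κ : Kind) → Finset (Ix κ) := fun κ =>
    (l.filterMap fun q => if h : q.κ = κ then some (h ▸ q.ix) else none).toFinset
  have hZ : ∀ q ∈ l, q.ix ∈ Z q.κ := by
    intro q hq
    simp only [Z, List.mem_toFinset, List.mem_filterMap]
    exact ⟨q, hq, by simp⟩
  have hR : ∀ κ, ∃ R : Set (Finset (Ix κ)), R.Finite ∧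
      (∀ s ∈ R, s.card ≤ 2 ∧ ∀ x ∈ s, weight κ x = 0) ∧
      ∀ o : Option ℕ, ((z.Y.card : ℕ∞) ≤ G κ → o = none) → ∃ s ∈ R, ∀ o' : Option ℕ,
        ((z.Y.card : ℕ∞) ≤ G κ → o' = none) →
        (∀ x ∈ s, hits o (set κ x) = hits o' (set κ x)) →
        ∀ x ∈ Z κ, hits o (set κ x) = hits o' (set κ x) := by
    refine Kind.forall ?_ ?_ ?_ ?_
    · refine ⟨{s | s ⊆ Z .light ∧ s.card ≤ 2}, ?_, fun s hs => ⟨hs.2, fun _ _ => rfl⟩,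
        fun o _ => ?_⟩
      · refine (Finset.finite_toSet (Z .light).powerset).subset fun s hs => ?_
        exact Finset.mem_coe.2 (Finset.mem_powerset.2 hs.1)
      · obtain ⟨s, h1, h2, h3⟩ := exists_threshold_certificate (Z .light) o
        exact ⟨s, ⟨h1, h2⟩, fun o' _ => h3 o'⟩
    · obtain ⟨R, h1, h2⟩ := exists_set_certificate (Z .sets)
      refine ⟨(fun A => ({A} : Finset (Set ℕ))) '' R, h1.image _, ?_, fun o _ => ?_⟩
      · rintro _ ⟨A, -, rfl⟩
        exact ⟨(Finset.card_singleton A).trans_le one_le_two, fun _ _ => rfl⟩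
      · obtain ⟨A, h3, h4⟩ := h2 o
        exact ⟨{A}, ⟨A, h3, rfl⟩, fun o' _ h => h4 o' (h A (Finset.mem_singleton_self A))⟩
    · refine ⟨{∅}, Set.finite_singleton _, by simp, fun o ho => ⟨∅, rfl, fun o' ho' _ x _ => ?_⟩⟩
      rw [ho hH, ho' hH]
    · refine ⟨{∅}, Set.finite_singleton _, by simp, fun o ho => ⟨∅, rfl, fun o' ho' _ x _ => ?_⟩⟩
      rw [ho hM, ho' hM]
  choose R hfin hR0 hR using hR
  let L : ((i : Σ κ, (Fin (ar G κ) → z.Y)) → Finset (Ix i.1)) → List (Query G) := fun S =>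
    Finset.univ.toList.flatMap fun i => (S i).toList.map fun x => inputQuery i.1 x i.2
  have hmem : ∀ S q, q ∈ L S ↔ ∃ i, ∃ x ∈ S i, inputQuery i.1 x i.2 = q := by
    intro S q; simp [L]
  refine cost_a_le_of_certificates z hl (L '' Set.pi Set.univ fun i => R i.1)
    ((Set.Finite.pi fun i => hfin i.1).image L) ?_ ?_
  · rintro _ ⟨S, hS, rfl⟩
    constructor
    · calc (L S).length = ∑ i, (S i).card := by
            simp [L, List.length_flatMap, Finset.sum_map_toList]
        _ ≤ ∑ i : Σ κ, (Fin (ar G κ) → z.Y), 2 :=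
            Finset.sum_le_sum fun i _ => (hR0 i.1 (S i) (hS i trivial)).1
        _ = 2 * ∑ κ, z.Y.card ^ ar G κ := by
            simp [mul_comm]
    · intro q hq
      obtain ⟨i, x, hx, rfl⟩ := (hmem S q).1 hq
      exact ((hR0 i.1 (S i) (hS i trivial)).2 x hx).trans_le (Nat.zero_le _)
  · intro a
    choose S hS1 hS2 using fun i : Σ κ, (Fin (ar G κ) → z.Y) =>
      hR i.1 (seen G i.1 fun l => a (i.2 l)) fun h => seen_eq_none h i.2 a
    refine ⟨L S, ⟨S, fun i _ => hS1 i, rfl⟩, fun a' h q hq => ?_⟩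
    rw [eval_env, eval_env]
    refine hS2 ⟨q.κ, fun l => source z.Y_nonempty (q.args l)⟩ _
      (fun h => seen_eq_none h _ a') (fun x hx => ?_) q.ix (hZ q hq)
    have := h _ ((hmem S _).2 ⟨⟨q.κ, fun l => source z.Y_nonempty (q.args l)⟩, x, hx, rfl⟩)
    rwa [eval_inputQuery, eval_inputQuery] at this

theorem not_unb_a {n : ℕ} (hH : (n : ℕ∞) ≤ G .heavy) (hM : (n : ℕ∞) ≤ G .medium) :
    ¬ (pair G).Unb n .a := by
  intro h
  obtain ⟨z, rfl, hz⟩ := h (2 * ∑ κ, n ^ ar G κ + 1)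
  have := cost_a_le z hH hM
  omega

theorem not_unb_d {n : ℕ} (h : ∀ κ, (n : ℕ∞) ≤ G κ) : ¬ (pair G).Unb n .d := by
  intro hd
  obtain ⟨z, rfl, hz⟩ := hd (2 * ∑ κ, n ^ ar G κ + 1)
  have := cost_d_le_max z ∅ (fun κ _ _ => Or.inl (h κ)) (by simp) (cost_a_le z (h _) (h _))
  simp only [Finset.sum_empty] at this
  omega

-- With the free kinds closed, only finitely many useful predicates have weight at most `m`, and all
-- of them can be asked.
open Classical in
theorem not_detUnb {n : ℕ} (hL : (n : ℕ∞) ≤ G .light) (hS : (n : ℕ∞) ≤ G .sets) :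
    ¬ (pair G).DetUnb n := by
  rintro ⟨m, hm⟩
  let J : Finset (Σ κ, Ix κ) := ((Finset.range (m + 1)).image (fun t : ℕ => (⟨.heavy, t⟩ : Σ κ, Ix κ)) ∪
    (Finset.range (2 ^ m + 1)).image fun t : ℕ => (⟨.medium, t⟩ : Σ κ, Ix κ)).filter
      fun i => weight i.1 i.2 ≤ m
  obtain ⟨z, rfl, h1, h2⟩ := hm (max m (∑ i ∈ J, n ^ ar G i.1) + 1)
  have := cost_d_le_max z J ?_ (fun i hi => (Finset.mem_filter.1 hi).2) h1
  · omega
  · refine Kind.forall (fun _ _ => Or.inl hL) (fun _ _ => Or.inl hS) (fun (t : ℕ) ht => Or.inr ?_)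
      (fun (t : ℕ) ht => Or.inr ?_)
    · refine Finset.mem_filter.2 ⟨Finset.mem_union_left _ (Finset.mem_image.2 ⟨t, ?_, rfl⟩), ht⟩
      have h3 : 2 ^ (t : ℕ) ≤ m := ht
      exact Finset.mem_range.2 ((Nat.lt_two_pow_self.trans_le h3).trans (Nat.lt_succ_self m))
    · refine Finset.mem_filter.2 ⟨Finset.mem_union_right _ (Finset.mem_image.2 ⟨t, ?_, rfl⟩), ht⟩
      have h3 : Nat.clog 2 t ≤ m := ht
      have h4 : (t : ℕ) ≤ 2 ^ m :=
        (Nat.le_pow_clog one_lt_two t).trans (Nat.pow_le_pow_right two_pos h3)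
      exact Finset.mem_range.2 (Nat.lt_succ_of_le h4)

theorem mul_succ_le_two_pow {s : ℕ} (hs : 5 ≤ s) : (s + 1) * s ≤ 2 ^ s := by
  induction s, hs using Nat.le_induction with
  | base => norm_num
  | succ s hs ih =>
    rw [pow_succ]
    nlinarith

-- Under the budget `2 ^ s` only the heavy thresholds `0, …, s` are usable, and asking all of them
-- on all tuples costs only linearly in `s`.
open Classical in
theorem not_gap {n : ℕ} (hL : (n : ℕ∞) ≤ G .light) (hS : (n : ℕ∞) ≤ G .sets)
    (hM : (n : ℕ∞) ≤ G .medium) : ¬ (pair G).Gap n := by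
  rintro ⟨c, hc⟩
  set K := n ^ ar G .heavy
  -- Large enough for `K ≤ s` and `c ≤ 2 ^ s`; the `5` is needed for `(s + 1) * s ≤ 2 ^ s`, which
  -- fails at `4`.
  set s := K + c + 5 with hs
  let J : Finset (Σ κ, Ix κ) :=
    (Finset.range (s + 1)).image (fun t : ℕ => (⟨.heavy, t⟩ : Σ κ, Ix κ))
  have hcs : c ≤ 2 ^ s := (by omega : c ≤ s).trans Nat.lt_two_pow_self.le
  obtain ⟨z, rfl, h1, h2⟩ := hc (2 ^ s) hcs
  have h3 := cost_d_le_max z J ?_ ?_ h1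
  · have h4 : ∑ i ∈ J, z.Y.card ^ ar G i.1 ≤ (s + 1) * K := by
      calc ∑ i ∈ J, z.Y.card ^ ar G i.1 = ∑ i ∈ J, K := Finset.sum_congr rfl fun i hi => by
            obtain ⟨t, -, rfl⟩ := Finset.mem_image.1 hi
            rfl
        _ = J.card * K := by simp
        _ ≤ (s + 1) * K := Nat.mul_le_mul_right _ (Finset.card_image_le.trans (by simp))
    have h5 : (s + 1) * K ≤ (s + 1) * s := Nat.mul_le_mul_left _ (by omega)
    have h6 := mul_succ_le_two_pow (s := s) (by omega)
    omega
  · refine Kind.forall (fun _ _ => Or.inl hL) (fun _ _ => Or.inl hS) (fun (t : ℕ) ht => Or.inr ?_)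
      (fun _ _ => Or.inl hM)
    refine Finset.mem_image.2 ⟨t, ?_, rfl⟩
    have h3 : 2 ^ (t : ℕ) ≤ 2 ^ s := ht
    exact Finset.mem_range.2 (Nat.lt_succ_of_le ((Nat.pow_le_pow_iff_right one_lt_two).1 h3))
  · intro i hi
    obtain ⟨t, ht, rfl⟩ := Finset.mem_image.1 hi
    exact Nat.pow_le_pow_right two_pos (Nat.lt_succ_iff.1 (Finset.mem_range.1 ht))

theorem cost_d_le_of_queries (z : Problem (pair G).U) {l : List (Query G)}
    (hl : l.map Query.expr = z.β) (l' : List (Query G))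
    (h : ∀ a a', (∀ q ∈ l', q.eval (env z.Y z.Y_nonempty a) = q.eval (env z.Y z.Y_nonempty a')) →
      ∀ q ∈ l, q.eval (env z.Y z.Y_nonempty a) = q.eval (env z.Y z.Y_nonempty a')) :
    (pair G).cost .d z ≤ (pair G).seqCost (l'.map Query.expr) := by
  obtain ⟨f, hf⟩ := z.exists_answer_fun
  refine SMPair.cost_d_le_of_determines _ z _ fun a =>
    ⟨f (evalPreds (env z.Y z.Y_nonempty a) z.β), fun a' ha' => ?_⟩
  rw [evalPreds_map_expr, evalPreds_map_expr, List.map_inj_left] at ha'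
  have : evalPreds (env z.Y z.Y_nonempty a) z.β = evalPreds (env z.Y z.Y_nonempty a') z.β := by
    rw [← hl, evalPreds_map_expr, evalPreds_map_expr]
    exact List.map_congr_left (h a a' fun q hq => (ha' q hq).symm)
  rw [this]
  exact hf _

/-- The kind of a query and the input variables that give its arguments. -/
def Query.sig (q : Query G) {Y : Finset ℕ} (hY : Y.Nonempty) : Σ κ, (Fin (ar G κ) → Y) :=
  ⟨q.κ, fun l => source hY (q.args l)⟩

theorem exists_threshold {q : Query G} {Y : Finset ℕ} {hY : Y.Nonempty}
    {t : Fin (ar G .light) → Y} (h : q.sig hY = ⟨.light, t⟩) : ∃ τ : ℕ, ∀ a,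
      q.eval (env Y hY a) = hits (seen G .light fun l => a (t l)) {v | τ ≤ v} := by
  obtain ⟨κ, x, args⟩ := q
  obtain ⟨h1, h2⟩ := Sigma.mk.inj_iff.1 h
  subst h1
  refine ⟨x, fun a => ?_⟩
  rw [eval_env, ← eq_of_heq h2]
  rfl

open Classical in
/-- Of three thresholds with the same arguments at most two have to be asked. -/
theorem cost_d_lt_of_light (z : Problem (pair G).U) {l : List (Query G)}
    (hl : l.map Query.expr = z.β) (hκ : ∀ q ∈ l, q.κ = .light)
    (hlen : 2 * z.Y.card ^ ar G .light < l.length) : (pair G).cost .d z ≤ l.length - 1 := by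
  have hw : ∀ q ∈ l, weight q.κ q.ix = 0 := by
    intro q hq
    have := hκ q hq
    obtain ⟨κ, x, args⟩ := q
    subst this
    rfl
  -- Pigeonhole: more than two queries per tuple of inputs, so three positions of the list ask
  -- thresholds of the same tuple.
  obtain ⟨y, hy, hcard⟩ := Finset.exists_lt_card_fiber_of_mul_lt_card_of_maps_to
    (s := (Finset.univ : Finset (Fin l.length)))
    (t := (Finset.univ : Finset (Fin (ar G .light) → z.Y)).image (Sigma.mk Kind.light))
    (f := fun j => (l.get j).sig z.Y_nonempty) (n := 2)
    (fun j _ => by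
      have := hκ _ (l.get_mem j)
      generalize l.get j = q at this
      obtain ⟨κ, x, args⟩ := q
      subst this
      exact Finset.mem_image.2 ⟨_, Finset.mem_univ _, rfl⟩)
    (by
      refine lt_of_le_of_lt ?_ (hlen.trans_eq (by simp))
      rw [mul_comm]
      exact Nat.mul_le_mul_left _ (Finset.card_image_le.trans (by simp)))
  obtain ⟨t, -, rfl⟩ := Finset.mem_image.1 hy
  set Φ := Finset.univ.filter fun j => (l.get j).sig z.Y_nonempty = ⟨Kind.light, t⟩ with hΦ
  have hτ : ∀ j, ∃ τ : ℕ, j ∈ Φ → ∀ a, (l.get j).eval (env z.Y z.Y_nonempty a) =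
      hits (seen G .light fun l => a (t l)) {v | τ ≤ v} := by
    intro j
    by_cases hj : j ∈ Φ
    · obtain ⟨τ, h⟩ := exists_threshold (Finset.mem_filter.1 hj).2
      exact ⟨τ, fun _ => h⟩
    · exact ⟨0, fun h => absurd h hj⟩
  choose τ hτ using hτ
  obtain ⟨lo, hlo, hlomin⟩ := Finset.exists_min_image Φ τ (Finset.card_pos.1 (by omega))
  have hc1 := Finset.card_erase_of_mem hlo
  obtain ⟨hi, hhi, hhimax⟩ := Finset.exists_max_image (Φ.erase lo) τ
    (Finset.card_pos.1 (by omega))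
  have hc2 := Finset.card_erase_of_mem hhi
  obtain ⟨mid, hmid⟩ := Finset.card_pos.1 (by omega : 0 < ((Φ.erase lo).erase hi).card)
  obtain ⟨hmh, hmid'⟩ := Finset.mem_erase.1 hmid
  obtain ⟨hml, hmid''⟩ := Finset.mem_erase.1 hmid'
  obtain ⟨hhl, hhi'⟩ := Finset.mem_erase.1 hhi
  have hmono : ∀ (o : Option ℕ) {s s' : ℕ}, s ≤ s' → hits o {v | s' ≤ v} = true →
      hits o {v | s ≤ v} = true := by
    intro o s s' h h'
    obtain ⟨v, h1, h2⟩ := hits_iff.1 h'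
    exact hits_iff.2 ⟨v, h1, h.trans h2⟩
  have hmidlo : ∀ a, (l.get mid).eval (env z.Y z.Y_nonempty a) = true →
      (l.get lo).eval (env z.Y z.Y_nonempty a) = true := fun a h => by
    rw [hτ _ hmid''] at h
    rw [hτ _ hlo]
    exact hmono _ (hlomin _ hmid'') h
  have hmidhi : ∀ a, (l.get mid).eval (env z.Y z.Y_nonempty a) = false →
      (l.get hi).eval (env z.Y z.Y_nonempty a) = false := fun a h => by
    by_contra h'
    rw [Bool.not_eq_false] at h'
    rw [hτ _ hhi'] at h'
    have := hmono _ (hhimax _ hmid') h'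
    rw [← hτ _ hmid'', h] at this
    exact Bool.false_ne_true this
  let rest : List (Query G) := (Finset.univ \ {lo, hi, mid}).toList.map l.get
  have hrest : rest.length = l.length - 3 := by
    have : ({lo, hi, mid} : Finset (Fin l.length)).card = 3 :=
      Finset.card_eq_three.2 ⟨lo, hi, mid, hhl.symm, hml.symm, hmh.symm, rfl⟩
    simp [rest, Finset.card_sdiff_of_subset (Finset.subset_univ _), this]
  have hrestl : ∀ q ∈ rest, q ∈ l := by
    intro q hq
    obtain ⟨j, -, rfl⟩ := List.mem_map.1 hq
    exact l.get_mem j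
  -- A positive middle threshold makes `lo` redundant, a negative one makes `hi` redundant. In total
  -- `1 + (l.length - 3) + 1` queries are asked.
  let E : Bool → List (Query G) := fun b => rest ++ [l.get (if b then hi else lo)]
  refine SMPair.cost_d_le_of_branch _ z (l.get mid).predExpr (fun b => (E b).map Query.expr)
    (fun a a' h1 h2 => ?_) fun b => ?_
  · have h1 : (l.get mid).eval (env z.Y z.Y_nonempty a) =
      (l.get mid).eval (env z.Y z.Y_nonempty a') := h1
    have hE : ∀ q ∈ E ((l.get mid).eval (env z.Y z.Y_nonempty a)),
        q.eval (env z.Y z.Y_nonempty a) = q.eval (env z.Y z.Y_nonempty a') := by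
      rw [evalPreds_map_expr, evalPreds_map_expr, List.map_inj_left] at h2
      exact h2
    rw [← hl, evalPreds_map_expr, evalPreds_map_expr]
    refine List.map_congr_left fun q hq => ?_
    obtain ⟨j, rfl⟩ := List.mem_iff_get.1 hq
    by_cases hj : j ∈ ({lo, hi, mid} : Finset (Fin l.length))
    · cases hb : (l.get mid).eval (env z.Y z.Y_nonempty a) with
      | true =>
        rw [hb] at hE h1
        simp only [Finset.mem_insert, Finset.mem_singleton] at hj
        rcases hj with rfl | rfl | rfl
        · rw [hmidlo a hb, hmidlo a' h1.symm]
        · exact hE _ (by simp [E])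
        · rw [hb, h1]
      | false =>
        rw [hb] at hE h1
        simp only [Finset.mem_insert, Finset.mem_singleton] at hj
        rcases hj with rfl | rfl | rfl
        · exact hE _ (by simp [E])
        · rw [hmidhi a hb, hmidhi a' h1.symm]
        · rw [hb, h1]
    · exact hE _ (List.mem_append_left _ (List.mem_map.2 ⟨j, by simpa using hj, rfl⟩))
  · refine seqCost_map_expr_le (l := l.get mid :: E b) ?_ fun q hq => ?_
    · simp only [E, List.length_cons, List.length_append, hrest, List.length_nil]
      have : l.length ≥ 3 := by
        have h3 : Φ.card ≤ l.length := (Finset.card_le_univ _).trans_eq (by simp)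
        omega
      omega
    · have : q ∈ l := by
        simp only [E, List.mem_cons, List.mem_append, List.not_mem_nil, or_false] at hq
        rcases hq with rfl | hq | rfl
        · exact l.get_mem _
        · exact hrestl q hq
        · exact l.get_mem _
      rw [hw q this]
      exact Nat.zero_le _

-- If the description contains a constant predicate, dropping it saves a query and leaves only
-- weight zero. Otherwise it consists of light thresholds, and a long enough list contains three on
-- one tuple, where again one query is saved.
open Classical in
theorem not_eqInf {n : ℕ} (hS : (n : ℕ∞) ≤ G .sets) (hH : (n : ℕ∞) ≤ G .heavy)
    (hM : (n : ℕ∞) ≤ G .medium) : ¬ (pair G).EqInf n := by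
  intro h
  obtain ⟨z, rfl, hdi, hz⟩ := h (2 * n ^ ar G .light + 1)
  obtain ⟨l, hl, hlen, -⟩ := exists_queries z.β
  set c := (pair G).cost .i z with hc
  have hlen : l.length ≤ c := hlen
  have hlight : ∀ q : Query G, ¬ (z.Y.card : ℕ∞) ≤ G q.κ → q.κ = .light := by
    rintro ⟨κ, x, args⟩ hq
    cases κ with
    | light => rfl
    | sets => exact absurd hS hq
    | heavy => exact absurd hH hq
    | medium => exact absurd hM hq
  have hweight : ∀ q : Query G, q.κ = .light → weight q.κ q.ix = 0 := by
    rintro ⟨κ, x, args⟩ hq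
    subst hq
    rfl
  by_cases hin : ∃ q ∈ l, (z.Y.card : ℕ∞) ≤ G q.κ
  · obtain ⟨q₀, hq₀, hq₀'⟩ := hin
    have hlt : (l.filter fun q => ¬ (z.Y.card : ℕ∞) ≤ G q.κ).length < l.length :=
      List.length_filter_lt_length_iff_exists.2 ⟨q₀, hq₀, by simpa using hq₀'⟩
    have h1 := cost_d_le_of_queries z hl (l.filter fun q => ¬ (z.Y.card : ℕ∞) ≤ G q.κ)
      (fun a a' h q hq => by
        by_cases hq' : (z.Y.card : ℕ∞) ≤ G q.κ
        · rw [eval_eq_false z.Y_nonempty hq', eval_eq_false z.Y_nonempty hq']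
        · exact h q (List.mem_filter.2 ⟨hq, by simpa using hq'⟩))
    have h2 := h1.trans (seqCost_map_expr_le (c := c - 1) (by omega) fun q hq => by
      rw [hweight q (hlight q (by simpa using (List.mem_filter.1 hq).2))]
      exact Nat.zero_le _)
    omega
  · push Not at hin
    have hκ : ∀ q ∈ l, q.κ = .light := fun q hq => hlight q (not_le.2 (hin q hq))
    have h3 : c ≤ l.length := by
      rw [hc]
      change (pair G).seqCost z.β ≤ _
      rw [← hl]
      refine seqCost_map_expr_le le_rfl fun q hq => ?_
      rw [hweight q (hκ q hq)]
      exact Nat.zero_le _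
    have := cost_d_lt_of_light z hl hκ (by omega)
    omega

end Gated

end SMPairs

namespace SMPairs

namespace Gated

variable {G : Kind → ℕ∞}

/-! ### Lower bounds -/

/-- The input whose variables hold different elements of the kind `κ`, the first one with the
value `v`. -/
def point (κ : Kind) (v : ℕ) {Y : Finset ℕ} : Y → (pair G).U.A :=
  fun y => (y.1, κ, if y.1 = 0 then v else 0)

variable (G) in
theorem range_ar_nonempty (κ : Kind) : (Finset.range (ar G κ)).Nonempty :=
  Finset.nonempty_range_iff.2 (Nat.succ_ne_zero _)

/-- The predicate applied to the first variables. -/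
def baseQuery (κ : Kind) (x : Ix κ) : Query G := ⟨κ, x, fun l => l⟩

/-- The tag of each element is the index of its variable, so different input variables hold
different elements whatever their values are. -/
theorem injective_point_iff (κ : Kind) (v : ℕ) {Y : Finset ℕ} {m : ℕ} (t : Fin m → Y) :
    Function.Injective (fun l => (point κ v (t l) : (pair G).U.A)) ↔ Function.Injective t :=
  ⟨fun h _ _ h' => h (congrArg (point (G := G) κ v) h'),
    fun h _ _ h' => h (Subtype.ext (congrArg Prod.fst h'))⟩

theorem seen_point {κ : Kind} (hκ : G κ ≠ ⊤) {Y : Finset ℕ} {t : Fin (ar G κ) → Y}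
    (ht : Function.Injective t) (v : ℕ) :
    seen G κ (fun l => (point κ v (t l) : (pair G).U.A)) =
      some (if (t ⟨0, Nat.succ_pos _⟩ : ℕ) = 0 then v else 0) :=
  if_pos ⟨hκ, (injective_point_iff (G := G) κ v t).2 ht, rfl⟩

theorem eval_baseQuery {κ : Kind} (hκ : G κ ≠ ⊤) (x : Ix κ) (v : ℕ) :
    (baseQuery κ x : Query G).eval
      (env (Finset.range (ar G κ)) (range_ar_nonempty G κ) (point κ v)) =
        hits (some v) (set κ x) := by
  rw [eval_env]
  have hs : ∀ l : Fin (ar G κ), (source (range_ar_nonempty G κ) l : ℕ) = l := fun l => by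
    simp [source]
  have hinj : Function.Injective fun l : Fin (ar G κ) => source (range_ar_nonempty G κ) l :=
    fun l l' h => Fin.ext (by rw [← hs l, ← hs l']; exact congrArg Subtype.val h)
  have := seen_point hκ hinj v
  rw [if_pos (hs _)] at this
  exact congrArg (fun o => hits o (set κ x)) this

/-- The problem to find the values of some predicates of a kind on the first variables. -/
noncomputable def baseProblem (κ : Kind) (xs : List (Ix κ)) (h : 0 < xs.length) :
    Problem (pair G).U :=
  Problem.ofFun (Finset.range (ar G κ)) (range_ar_nonempty G κ)
    ((xs.map (baseQuery κ)).map Query.expr)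
    (by rw [numPred_map_expr, List.length_map]; exact h) Encodable.encode

theorem card_baseProblem (κ : Kind) (xs : List (Ix κ)) (h : 0 < xs.length) :
    (baseProblem κ xs h : Problem (pair G).U).Y.card = ar G κ := Finset.card_range _

/-- Values separated by the predicates yield different value lists, hence need different leaves of a
deterministic tree. -/
theorem le_two_pow_cost_d {κ : Kind} (hκ : G κ ≠ ⊤) (xs : List (Ix κ)) (h : 0 < xs.length) (N : ℕ)
    (hN : ∀ v < N, ∀ v' < N, (∀ x ∈ xs, hits (some v) (set κ x) = hits (some v') (set κ x)) →
      v = v') : N ≤ 2 ^ (pair G).cost .d (baseProblem κ xs h) := by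
  classical
  refine le_trans ?_ (SMPair.card_le_two_pow (pair G) length_le_ψ
    ((Finset.range N).image fun v => xs.map fun x => hits (some v) (set κ x)) ?_)
  · rw [Finset.card_image_of_injOn, Finset.card_range]
    intro v hv v' hv' h'
    exact hN v (by simpa using hv) v' (by simpa using hv') (List.map_inj_left.1 h')
  · intro w hw
    obtain ⟨v, -, rfl⟩ := Finset.mem_image.1 hw
    refine ⟨point κ v, ?_⟩
    rw [evalPreds_map_expr, List.map_map]
    exact List.map_congr_left fun x _ => eval_baseQuery hκ x v

section Thresholds

variable {κ : Kind} {th : ℕ → Ix κ} (hth : ∀ t, set κ (th t) = {v | t ≤ v}) {N : ℕ} (hN : 0 < N)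

/-- The problem to compare a value with the thresholds `1, …, N`. -/
noncomputable def thresholdProblem (th : ℕ → Ix κ) {N : ℕ} (hN : 0 < N) : Problem (pair G).U :=
  baseProblem κ ((List.range N).map fun t => th (t + 1)) (by simpa using hN)

include hth

/-- The values `0, …, N` lie in `N + 1` different positions relative to the thresholds, whence the
strict inequality. -/
theorem lt_two_pow_cost_d (hκ : G κ ≠ ⊤) :
    N < 2 ^ (pair G).cost .d (thresholdProblem th hN) := by
  refine le_two_pow_cost_d hκ _ _ (N + 1) ?_
  have key : ∀ v v', v < v' → v' < N + 1 → ¬ ∀ x ∈ (List.range N).map fun t => th (t + 1),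
      hits (some v) (set κ x) = hits (some v') (set κ x) := by
    intro v v' h1 h2 h3
    have h4 := h3 (th (v + 1)) (List.mem_map.2 ⟨v, List.mem_range.2 (by omega), rfl⟩)
    rw [hth, Bool.eq_iff_iff, hits_iff, hits_iff] at h4
    simp only [Option.mem_def, Option.some.injEq, Set.mem_ofPred_eq, exists_eq_left'] at h4
    omega
  intro v hv v' hv' h
  rcases lt_trichotomy v v' with h1 | h1 | h1
  · exact absurd h (key v v' h1 hv')
  · exact h1
  · exact absurd (fun x hx => (h x hx).symm) (key v' v h1 hv)

theorem cost_a_thresholdProblem_le {m : ℕ} (hm : 2 ≤ m) (hw : ∀ t ≤ N, weight κ (th t) ≤ m) :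
    (pair G).cost .a (thresholdProblem th hN) ≤ m := by
  refine cost_a_le_of_certificates _ rfl
    ((fun s : Finset ℕ => s.toList.map fun t => baseQuery κ (th t)) ''
      {s | s ⊆ Finset.Icc 1 N ∧ s.card ≤ 2}) (Set.Finite.image _ ?_) ?_ ?_
  · refine (Finset.finite_toSet (Finset.Icc 1 N).powerset).subset fun s hs => ?_
    exact Finset.mem_coe.2 (Finset.mem_powerset.2 hs.1)
  · rintro _ ⟨s, ⟨h1, h2⟩, rfl⟩
    refine ⟨by simpa using h2.trans hm, ?_⟩
    simp only [List.mem_map, Finset.mem_toList]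
    rintro q ⟨t, ht, rfl⟩
    exact hw t (Finset.mem_Icc.1 (h1 ht)).2
  · intro a
    obtain ⟨s, h1, h2, h3⟩ := exists_threshold_certificate (Finset.Icc 1 N)
      (seen G κ fun l => a (source (range_ar_nonempty G κ) l))
    refine ⟨_, ⟨s, ⟨h1, h2⟩, rfl⟩, fun a' h q hq => ?_⟩
    have heval : ∀ a t, (baseQuery κ (th t) : Query G).eval
        (env (Finset.range (ar G κ)) (range_ar_nonempty G κ) a) =
        hits (seen G κ fun l => a (source (range_ar_nonempty G κ) l)) {v | t ≤ v} := by
      intro a t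
      rw [eval_env, ← hth]
      rfl
    simp only [List.mem_map, List.mem_range] at hq
    obtain ⟨_, ⟨t, ht, rfl⟩, rfl⟩ := hq
    refine (heval a _).trans (Eq.trans ?_ (heval a' _).symm)
    refine h3 _ (fun t' ht' => ?_) (t + 1) (Finset.mem_Icc.2 ⟨by omega, by omega⟩)
    have := h (baseQuery κ (th t')) (List.mem_map.2 ⟨t', Finset.mem_toList.2 ht', rfl⟩)
    exact (heval a _).symm.trans (this.trans (heval a' _))

end Thresholds

/-- One predicate repeated in the description suffices, since the cost is at least the length. -/
theorem unb_i {n : ℕ} (hn : 0 < n) : (pair G).Unb n .i := by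
  refine SMPair.unb_i_iff (n' := ar G .light) hn fun m => ?_
  let xs : List (Ix .light) := List.replicate (m + 1) (0 : ℕ)
  have hxs : xs.length = m + 1 := List.length_replicate
  refine ⟨baseProblem .light xs (by omega), card_baseProblem _ _ _, ?_⟩
  refine le_trans ?_ (length_le_ψ (G := G) _)
  simp only [baseProblem, Problem.ofFun, List.length_map]
  omega

theorem ar_of_eq {κ : Kind} {g : ℕ} (hg : G κ = g) : ar G κ = g + 1 := by
  simp [ar, hg]

theorem ne_top_of_eq {κ : Kind} {g : ℕ} (hg : G κ = g) : G κ ≠ ⊤ := by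
  simp [hg]

/-- Locating a value among `2 ^ m` free thresholds needs depth above `m`, whereas two of them
certify its position. -/
theorem detUnb {g n : ℕ} (hg : G .light = g) (hn : g < n) : (pair G).DetUnb n := by
  refine Nat.le_induction (m := g + 1) ?_ (fun n _ h => h.succ) n hn
  refine ⟨2, fun m => ⟨thresholdProblem (κ := .light) (fun t => t) (Nat.two_pow_pos m),
    (card_baseProblem _ _ _).trans (ar_of_eq hg), ?_, ?_⟩⟩
  · exact cost_a_thresholdProblem_le (κ := .light) (th := fun t => t) (fun _ => rfl) _ le_rfl
      fun _ _ => Nat.zero_le _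
  · have := lt_two_pow_cost_d (κ := .light) (th := fun t => t) (fun _ => rfl) (Nat.two_pow_pos m)
      (ne_top_of_eq hg)
    exact ((Nat.pow_lt_pow_iff_right one_lt_two).1 this).le

/-- The thresholds `1, …, 2 ^ m` have weight at most `m`, so certificates fit the budget `m`, but
the `2 ^ m + 1` positions need depth above `m`. -/
theorem gap {g n : ℕ} (hg : G .medium = g) (hn : g < n) : (pair G).Gap n := by
  refine Nat.le_induction (m := g + 1) ?_ (fun n _ h => h.succ) n hn
  refine ⟨2, fun m hm => ⟨thresholdProblem (κ := .medium) (fun t => t) (Nat.two_pow_pos m),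
    (card_baseProblem _ _ _).trans (ar_of_eq hg), ?_, ?_⟩⟩
  · exact cost_a_thresholdProblem_le (κ := .medium) (th := fun t => t) (fun _ => rfl) _ hm
      fun t ht => Nat.clog_le_of_le_pow ht
  · have := lt_two_pow_cost_d (κ := .medium) (th := fun t => t) (fun _ => rfl) (Nat.two_pow_pos m)
      (ne_top_of_eq hg)
    exact (Nat.pow_lt_pow_iff_right one_lt_two).1 this

/-- The first `m + 1` binary digits are independent, so no deterministic tree beats reading all of
them. -/
theorem eqInf {g n : ℕ} (hg : G .sets = g) (hn : g < n) : (pair G).EqInf n := by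
  refine Nat.le_induction (m := g + 1) ?_ (fun n _ h => h.succ) n hn
  intro m
  let xs : List (Ix .sets) := (List.range (m + 1)).map fun j => {v : ℕ | v.testBit j = true}
  have hxs : xs.length = m + 1 := List.length_map _ |>.trans List.length_range
  refine ⟨baseProblem .sets xs (by omega), (card_baseProblem _ _ _).trans (ar_of_eq hg), ?_⟩
  have h1 : 2 ^ (m + 1) ≤ 2 ^ (pair G).cost .d (baseProblem .sets xs (by omega)) := by
    refine le_two_pow_cost_d (ne_top_of_eq hg) _ _ _ fun v hv v' hv' h => ?_
    refine Nat.eq_of_testBit_eq fun j => ?_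
    by_cases hj : j < m + 1
    · have h2 := h {v : ℕ | v.testBit j = true} (List.mem_map.2 ⟨j, List.mem_range.2 hj, rfl⟩)
      rw [Bool.eq_iff_iff, hits_iff, hits_iff] at h2
      simp only [Option.mem_def, Option.some.injEq, exists_eq_left'] at h2
      rw [Bool.eq_iff_iff]
      exact h2
    · have h3 : 2 ^ (m + 1) ≤ 2 ^ j := Nat.pow_le_pow_right two_pos (by omega)
      rw [Nat.testBit_lt_two_pow (hv.trans_le h3), Nat.testBit_lt_two_pow (hv'.trans_le h3)]
  have h2 := (Nat.pow_le_pow_iff_right one_lt_two).1 h1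
  have h3 := SMPair.cost_d_le_i (pair G) (baseProblem .sets xs (by omega))
  have h4 : (pair G).cost .i (baseProblem .sets xs (by omega)) ≤ m + 1 :=
    seqCost_map_expr_le (by simp [hxs]) fun q hq => by
      obtain ⟨x, -, rfl⟩ := List.mem_map.1 hq
      exact Nat.zero_le _
  omega

/-- Predicates of weight less than `2 ^ t` do not distinguish the values `t` and `t - 1` of an
element of the kind `heavy`. -/
theorem eval_point_heavy {q : Query G} {t : ℕ} (hq : weight q.κ q.ix < 2 ^ (t + 1)) {Y : Finset ℕ}
    (hY : Y.Nonempty) :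
    q.eval (env Y hY (point .heavy t)) = q.eval (env Y hY (point .heavy (t + 1))) := by
  obtain ⟨κ, x, args⟩ := q
  rw [eval_env, eval_env]
  by_cases hc : κ = .heavy ∧ G .heavy ≠ ⊤ ∧ Function.Injective fun l => source hY (args l)
  · obtain ⟨rfl, hG, hinj⟩ := hc
    refine (congrArg (fun o => hits o (set .heavy x)) (seen_point hG hinj t)).trans
      (Eq.trans ?_ (congrArg (fun o => hits o (set .heavy x)) (seen_point hG hinj (t + 1))).symm)
    have hx : ∀ x' : ℕ, x' = x → x' < t + 1 := fun x' h =>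
      (Nat.pow_lt_pow_iff_right one_lt_two).1 (h ▸ hq)
    -- The value is visible only if the first argument is the variable with index `0`; otherwise
    -- both points show the value `0`.
    split_ifs
    · rw [Bool.eq_iff_iff, hits_iff, hits_iff]
      simp only [Option.mem_def, Option.some.injEq, exists_eq_left']
      exact ⟨fun _ => (hx x rfl).le, fun _ => Nat.lt_succ_iff.1 (hx x rfl)⟩
    · rfl
  · have hnone : ∀ v, seen G κ (fun l => (point .heavy v (source hY (args l)) : (pair G).U.A)) =
        none := by
      intro v
      refine if_neg fun h => hc ?_
      obtain ⟨h1, h2, h3⟩ := h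
      have h3 : Kind.heavy = κ := h3
      subst h3
      exact ⟨rfl, h1, (injective_point_iff (G := G) _ v _).1 h2⟩
    exact congrArg (fun o => hits o (set κ x)) ((hnone t).trans (hnone (t + 1)).symm)

/-- A path of cost below `2 ^ (m + 1)` cannot tell the value `m` from `m + 1`, while the threshold
`m + 1` requires different answers for them. -/
theorem unb_a {g n : ℕ} (hg : G .heavy = g) (hn : g < n) : (pair G).Unb n .a := by
  refine Nat.le_induction (m := g + 1) ?_ (fun n _ h => h.succ) n hn
  intro m
  let z : Problem (pair G).U := baseProblem .heavy [(m + 1 : ℕ)] Nat.one_pos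
  refine ⟨z, (card_baseProblem _ _ _).trans (ar_of_eq hg), ?_⟩
  have hm : m ≤ 2 ^ (m + 1) := (by omega : m ≤ m + 1).trans Nat.lt_two_pow_self.le
  refine hm.trans ?_
  by_contra hlt
  obtain ⟨Ξ, h1, h2⟩ := (SMPair.cost_a_le_iff _ z _).1 le_rfl
  obtain ⟨⟨ξ, h3, h4⟩, h5⟩ := h1 (point .heavy (m + 1))
  have h6 := h5 ξ h3 h4
  obtain ⟨l, hl, -, hlw⟩ := exists_queries ξ.β
  have h7 : ξ.Accepts (env z.Y z.Y_nonempty (point .heavy m)) :=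
    accepts_of_eval_eq hl (fun q hq => (eval_point_heavy
      (((hlw q hq).trans (h2 ξ h3)).trans_lt (not_le.1 hlt)) _).symm) h4
  have h8 := (h1 _).2 ξ h3 h7
  have hans : ∀ v, z.ans (env z.Y z.Y_nonempty (point .heavy v)) =
      {Encodable.encode [hits (some v) {w | m + 1 ≤ w}]} := by
    intro v
    have : evalPreds (env z.Y z.Y_nonempty (point .heavy v)) z.β =
        [hits (some v) {w | m + 1 ≤ w}] :=
      (evalPreds_map_expr [baseQuery .heavy (m + 1 : ℕ)] _).trans
        (congrArg (fun b => [b]) (eval_baseQuery (ne_top_of_eq hg) (m + 1 : ℕ) v))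
    rw [← this]
    rfl
  rw [hans, Finset.mem_singleton] at h6 h8
  have h9 := Encodable.encode_injective (h6.symm.trans h8)
  simp [hits] at h9

/-! ### Realization of the dynamic types -/

theorem dtyp_T1 : ∃ S : SMPair.{0}, S.dtyp = inf T1 := by
  refine ⟨⟨struc fun _ => ⊤, fun _ => 0⟩, funext fun k => ?_⟩
  refine SMPair.nTyp_eq_T1 k.succ_pos fun h => ?_
  obtain ⟨z, -, hz⟩ := h 1
  exact absurd hz (by simp [SMPair.cost, SMPair.seqCost])

/-- The gates of the four kinds of predicates. -/
def gates (l s h m : ℕ∞) : Kind → ℕ∞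
  | .light => l
  | .sets => s
  | .heavy => h
  | .medium => m

theorem cast_succ_le {k g : ℕ} (h : k < g) : ((k + 1 : ℕ) : ℕ∞) ≤ g := Nat.cast_le.2 h

theorem dtyp_T2 : (pair fun _ => ⊤).dtyp = inf T2 :=
  funext fun k => SMPair.nTyp_eq_T2 k.succ_pos (unb_i k.succ_pos) (not_unb_d fun _ => le_top)

theorem nTyp_T2 {G : Kind → ℕ∞} {k : ℕ} (h : ∀ κ, ((k + 1 : ℕ) : ℕ∞) ≤ G κ) :
    (pair G).nTyp (k + 1) = T2 :=
  SMPair.nTyp_eq_T2 k.succ_pos (unb_i k.succ_pos) (not_unb_d h)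

theorem nTyp_T3 {G : Kind → ℕ∞} {k g : ℕ} (hl : G .light = g) (hg : g ≤ k)
    (hs : ((k + 1 : ℕ) : ℕ∞) ≤ G .sets) (hh : ((k + 1 : ℕ) : ℕ∞) ≤ G .heavy)
    (hm : ((k + 1 : ℕ) : ℕ∞) ≤ G .medium) : (pair G).nTyp (k + 1) = T3 :=
  SMPair.nTyp_eq_T3 k.succ_pos (detUnb hl (Nat.lt_succ_of_le hg)).unb_d (not_unb_a hh hm)
    (not_eqInf hs hh hm)

theorem nTyp_T4 {G : Kind → ℕ∞} {k g : ℕ} (hs : G .sets = g) (hg : g ≤ k)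
    (hh : ((k + 1 : ℕ) : ℕ∞) ≤ G .heavy) (hm : ((k + 1 : ℕ) : ℕ∞) ≤ G .medium) :
    (pair G).nTyp (k + 1) = T4 :=
  SMPair.nTyp_eq_T4 k.succ_pos (eqInf hs (Nat.lt_succ_of_le hg)).unb_d (not_unb_a hh hm)
    (eqInf hs (Nat.lt_succ_of_le hg))

theorem nTyp_T5 {G : Kind → ℕ∞} {k g : ℕ} (hh : G .heavy = g) (hg : g ≤ k)
    (hl : ((k + 1 : ℕ) : ℕ∞) ≤ G .light) (hs : ((k + 1 : ℕ) : ℕ∞) ≤ G .sets)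
    (hm : ((k + 1 : ℕ) : ℕ∞) ≤ G .medium) : (pair G).nTyp (k + 1) = T5 :=
  SMPair.nTyp_eq_T5 (unb_a hh (Nat.lt_succ_of_le hg)) (not_detUnb hl hs) (not_gap hl hs hm)

theorem nTyp_T6 {G : Kind → ℕ∞} {k g g' : ℕ} (hh : G .heavy = g) (hg : g ≤ k)
    (hm : G .medium = g') (hg' : g' ≤ k) (hl : ((k + 1 : ℕ) : ℕ∞) ≤ G .light)
    (hs : ((k + 1 : ℕ) : ℕ∞) ≤ G .sets) : (pair G).nTyp (k + 1) = T6 :=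
  SMPair.nTyp_eq_T6 (unb_a hh (Nat.lt_succ_of_le hg)) (not_detUnb hl hs)
    (gap hm (Nat.lt_succ_of_le hg'))

theorem nTyp_T7 {G : Kind → ℕ∞} {k g g' : ℕ} (hh : G .heavy = g) (hg : g ≤ k)
    (hl : G .light = g') (hg' : g' ≤ k) : (pair G).nTyp (k + 1) = T7 :=
  SMPair.nTyp_eq_T7 (unb_a hh (Nat.lt_succ_of_le hg)) (detUnb hl (Nat.lt_succ_of_le hg'))

/-- The partial sums of the exponents serve as gates: each kind opens exactly where its condition
has to start, and `⊤` keeps a kind closed forever. For `T7` both the heavy and the light kind must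
be open. -/
theorem exists_dtyp_eq {σ : Stream' Table} (hσ : σ ∈ ({inf T1} ∪ Delta : Set (Stream' Table))) :
    ∃ S : SMPair.{0}, S.dtyp = σ := by
  simp only [Delta, List.append_assoc, Stream'.append_append_stream, Set.mem_union,
    Set.mem_singleton_iff, Set.mem_ofPred_eq] at hσ
  rcases hσ with rfl | (((((rfl | ⟨i, rfl⟩) | ⟨i, j, rfl⟩) | ⟨i, j, k, rfl⟩) | ⟨i, rfl⟩) |
    ⟨i, j, rfl⟩) | ⟨i, j, k, rfl⟩
  · exact dtyp_T1
  · exact ⟨_, dtyp_T2⟩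
  · refine ⟨pair (gates i ⊤ ⊤ ⊤), funext fun n => ?_⟩
    rw [SMPair.dtyp_apply, pow_append_apply, inf_apply]
    split_ifs with h1
    · exact nTyp_T2 (Kind.forall (cast_succ_le h1) le_top le_top le_top)
    · exact nTyp_T3 (g := i) rfl (by omega) le_top le_top le_top
  · refine ⟨pair (gates i (i + j : ℕ) ⊤ ⊤), funext fun n => ?_⟩
    rw [SMPair.dtyp_apply, pow_append_apply, pow_append_apply, inf_apply]
    split_ifs with h1 h2
    · exact nTyp_T2 (Kind.forall (cast_succ_le h1) (cast_succ_le (by omega)) le_top le_top)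
    · exact nTyp_T3 (g := i) rfl (by omega) (cast_succ_le (by omega)) le_top le_top
    · exact nTyp_T4 (g := i + j) rfl (by omega) le_top le_top
  · refine ⟨pair (gates i (i + j : ℕ) (i + j + k : ℕ) ⊤), funext fun n => ?_⟩
    rw [SMPair.dtyp_apply, pow_append_apply, pow_append_apply, pow_append_apply, inf_apply]
    split_ifs with h1 h2 h3
    · exact nTyp_T2 (Kind.forall (cast_succ_le h1) (cast_succ_le (by omega))
        (cast_succ_le (by omega)) le_top)
    · exact nTyp_T3 (g := i) rfl (by omega) (cast_succ_le (by omega)) (cast_succ_le (by omega))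
        le_top
    · exact nTyp_T4 (g := i + j) rfl (by omega) (cast_succ_le (by omega)) le_top
    · exact nTyp_T7 (g := i + j + k) (g' := i) rfl (by omega) rfl (by omega)
  · refine ⟨pair (gates ⊤ ⊤ i ⊤), funext fun n => ?_⟩
    rw [SMPair.dtyp_apply, pow_append_apply, inf_apply]
    split_ifs with h1
    · exact nTyp_T2 (Kind.forall le_top le_top (cast_succ_le h1) le_top)
    · exact nTyp_T5 (g := i) rfl (by omega) le_top le_top le_top
  · refine ⟨pair (gates ⊤ ⊤ i (i + j : ℕ)), funext fun n => ?_⟩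
    rw [SMPair.dtyp_apply, pow_append_apply, pow_append_apply, inf_apply]
    split_ifs with h1 h2
    · exact nTyp_T2 (Kind.forall le_top le_top (cast_succ_le h1) (cast_succ_le (by omega)))
    · exact nTyp_T5 (g := i) rfl (by omega) le_top le_top (cast_succ_le (by omega))
    · exact nTyp_T6 (g := i) (g' := i + j) rfl (by omega) rfl (by omega) le_top le_top
  · refine ⟨pair (gates (i + j + k : ℕ) ⊤ i (i + j : ℕ)), funext fun n => ?_⟩
    rw [SMPair.dtyp_apply, pow_append_apply, pow_append_apply, pow_append_apply, inf_apply]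
    split_ifs with h1 h2 h3
    · exact nTyp_T2 (Kind.forall (cast_succ_le (by omega)) le_top (cast_succ_le h1)
        (cast_succ_le (by omega)))
    · exact nTyp_T5 (g := i) rfl (by omega) (cast_succ_le (by omega)) le_top
        (cast_succ_le (by omega))
    · exact nTyp_T6 (g := i) (g' := i + j) rfl (by omega) rfl (by omega)
        (cast_succ_le (by omega)) le_top
    · exact nTyp_T7 (g := i) (g' := i + j + k) rfl (by omega) rfl (by omega)

end Gated

/-! ### The set of `n`-types -/

theorem SMPair.nTyp_mem (S : SMPair.{u}) {n : ℕ} (hn : 0 < n) :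
    S.nTyp n ∈ ({T1, T2, T3, T4, T5, T6, T7} : Set Table) := by
  rw [SMPair.nTyp_eq hn]
  simp only [Set.mem_insert_iff, Set.mem_singleton_iff]
  split_ifs <;> tauto

/-- With all exponents zero, every constant sequence is among the realized ones, so one pair per
table serves every `n`. -/
theorem exists_dtyp_eq_inf {T : Table} (hT : T ∈ ({T1, T2, T3, T4, T5, T6, T7} : Set Table)) :
    ∃ S : SMPair.{0}, S.dtyp = inf T := by
  apply Gated.exists_dtyp_eq
  simp only [Set.mem_insert_iff, Set.mem_singleton_iff] at hT
  rcases hT with rfl | rfl | rfl | rfl | rfl | rfl | rfl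
  · exact .inl rfl
  · exact .inr <| .inl <| .inl <| .inl <| .inl <| .inl <| .inl rfl
  · exact .inr <| .inl <| .inl <| .inl <| .inl <| .inl <| .inr ⟨0, rfl⟩
  · exact .inr <| .inl <| .inl <| .inl <| .inl <| .inr ⟨0, 0, rfl⟩
  · exact .inr <| .inl <| .inl <| .inr ⟨0, rfl⟩
  · exact .inr <| .inl <| .inr ⟨0, 0, rfl⟩
  · exact .inr <| .inr ⟨0, 0, 0, rfl⟩

end SMPairs

theorem theorem1 :
    (∀ S : SMPairs.SMPair.{u}, S.dtyp ∈ ({SMPairs.inf SMPairs.T1} ∪ SMPairs.Delta : Set (Stream' SMPairs.Table))) ∧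
    (∀ σ ∈ ({SMPairs.inf SMPairs.T1} ∪ SMPairs.Delta : Set (Stream' SMPairs.Table)),
      ∃ S : SMPairs.SMPair.{0}, S.dtyp = σ) ∧
    (∀ n : ℕ, 1 ≤ n →
      (∀ S : SMPairs.SMPair.{u}, S.nTyp n ∈ ({SMPairs.T1, SMPairs.T2, SMPairs.T3, SMPairs.T4,
        SMPairs.T5, SMPairs.T6, SMPairs.T7} : Set SMPairs.Table)) ∧
      (∀ T ∈ ({SMPairs.T1, SMPairs.T2, SMPairs.T3, SMPairs.T4,
        SMPairs.T5, SMPairs.T6, SMPairs.T7} : Set SMPairs.Table),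
        ∃ S : SMPairs.SMPair.{0}, S.nTyp n = T)) := by
  refine ⟨fun S => S.dtyp_mem, fun σ hσ => SMPairs.Gated.exists_dtyp_eq hσ, fun n hn =>
    ⟨fun S => S.nTyp_mem hn, fun T hT => ?_⟩⟩
  obtain ⟨S, hS⟩ := SMPairs.exists_dtyp_eq_inf hT
  obtain ⟨k, rfl⟩ := Nat.exists_eq_succ_of_ne_zero (Nat.one_le_iff_ne_zero.1 hn)
  exact ⟨S, congrFun hS k⟩
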